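/- Notation. Let $n,T,L\ge 1$, let $K\subseteq[0,1]^n$ be non-empty, convex and down-closed ($0\le y\le z\in K$ implies $y\in K$), and let $D$ be its Euclidean diameter. Let $F^1,\dots,F^T:[0,1]^n\to\mathbb R_{\ge 0}$ be fixed in advance; they are differentiable, $G$-Lipschitz, $\beta$-smooth on $K$ (that is, $\|\nabla F^t(x)-\nabla F^t(y)\|\le\beta\|x-y\|$ for $x,y\in K$), DR-submodular ($F(x+\alpha e_i)-F(x)\le F(y+\alpha e_i)-F(y)$ whenever $x\ge y$, $\alpha>0$ and all points lie in $[0,1]^n$), and not necessarily monotone. Write $(x\vee y)_i=\max(x_i,y_i)$. Algorithm (Meta-Frank-Wolfe). There are $L$ online vee-learning oracles $\mathcal E_1,\dots,\mathcal E_L$. In round $t$, oracle $\mathcal E_\ell$ outputs $u^t_\ell\in K$. Put $x^t_1=0$ and $x^t_{\ell+1}=x^t_\ell+\frac1L\,(x^t_\ell\vee u^t_\ell-x^t_\ell)$ for $1\le \ell\le L$, and play $x^t=x^t_{L+1}$. Then obtain stochastic gradients $g^t_\ell$ with $\mathbb E[g^t_\ell\mid \text{history}]=\nabla F^t(x^t_\ell)$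 and $\mathbb E\|g^t_\ell-\nabla F^t(x^t_\ell)\|^2\le\sigma^2$, where the history consists of everything drawn before $g^t_\ell$: all rounding choices up to and including round $t$ and all earlier stochastic gradients. Put $d^t_0=0$ and $d^t_\ell=(1-\rho_\ell)d^t_{\ell-1}+\rho_\ell g^t_\ell$ with $\rho_\ell=2/(\ell+3)^{2/3}$, and feed the reward $\langle d^t_\ell, x^t_\ell\vee\cdot\,\rangle$ back to $\mathcal E_\ell$. Vee-learning oracle. Let $M=\lceil (T/n)^{1/4}\rceil$ and let $\mathcal L=\{0,\frac1M,\dots,1\}^n$. The map $m$ sends $x\in\mathcal L$ to the vector $m(x)\in\{0,1\}^{n\times M}$ whose $i$-th block is $Mx_i$ ones followed by zeros. Let $\mathcal C=\mathrm{conv}\,m(K\cap\mathcal L)$. The oracle keeps a point $y^t\in\mathcal C$. It represents $y^t$, up to Euclidean error $1/\sqrt T$, as the average of $m(p_1),\dots,m(p_k)$ with $p_j\in K\cap\mathcal L$, and outputs one $p_j$, drawn uniformly and independently of the history. After the feedback $\langle a^t,c^t\vee\cdot\,\rangle$ it forms the linear reward $r^t=\tilde a^t\circ(1-m(\bar c^t))$,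 where $\tilde a^t_{i,j}=a^t_i/M$ and $\bar c^t$ is $c^t$ rounded down to $\mathcal L$. It then updates $y^t$ in one of two ways: either by projected gradient ascent $y^{t+1}=\mathrm{Proj}_{\mathcal C}(y^t+\eta r^t)$ with $\eta=\sqrt{nM}/(G\sqrt T)$, started at any point $y^1\in m(K\cap\mathcal L)$, or by any other procedure with expected regret $\sum_t\mathbb E\langle r^t,z-y^t\rangle\le c\,nMG\sqrt T$ for all $z\in\mathcal C$. Theorem. For every $c\ge0$ there is a constant $C>0$, depending on nothing else, such that for every $x^*\in K$ $$\sum_{t=1}^T\mathbb E[F^t(x^t)]\ \ge\ \Bigl(\frac1e-\frac CL\Bigr)\sum_{t=1}^TF^t(x^*)-C\,n^{3/4}G\,T^{3/4}-C\,\frac{(\beta D+G+\sigma)\,D\,T}{L^{1/3}} ,$$ and, if $L=\lceil T^{3/4}\rceil$, then for every $x^*\in K$ $$\sum_{t=1}^T\mathbb E[F^t(x^t)]\ \ge\ \Bigl(\frac1e-\frac C{T^{3/4}}\Bigr)\sum_{t=1}^TF^t(x^*)-C\,(G+\sigma)\,n^{5/4}\,T^{3/4}.$$ (The random variables $F^t(x^t)$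 are integrable.) -/

import Mathlib

open MeasureTheory ProbabilityTheory

namespace OnlineDR

/-- Vectors of `ℝⁿ` with the Euclidean norm. -/
abbrev Vec (n : ℕ) : Type := EuclideanSpace ℝ (Fin n)

/-- Vectors of the lifted space `ℝ^(n × M)` with the Euclidean norm. -/
abbrev LVec (n M : ℕ) : Type := EuclideanSpace ℝ (Fin n × Fin M)

/-! ### Sets and functions -/

/-- The hypercube `[0,1]ⁿ`. -/
def cube (n : ℕ) : Set (Vec n) := {x | ∀ i, 0 ≤ x i ∧ x i ≤ 1}

/-- `K ⊆ [0,1]ⁿ` is down-closed: `0 ≤ y ≤ z` and `z ∈ K` imply `y ∈ K`. -/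
def DownClosed {n : ℕ} (K : Set (Vec n)) : Prop :=
  ∀ z ∈ K, ∀ y : Vec n, (∀ i, 0 ≤ y i ∧ y i ≤ z i) → y ∈ K

/-- Coordinate-wise maximum `x ∨ y`. -/
noncomputable def vee {n : ℕ} (x y : Vec n) : Vec n :=
  WithLp.toLp 2 fun i => max (x i) (y i)

/-- The diminishing-returns property of `F` on `[0,1]ⁿ`. -/
def DRSubmodular {n : ℕ} (F : Vec n → ℝ) : Prop :=
  ∀ x ∈ cube n, ∀ y ∈ cube n, (∀ i, y i ≤ x i) → ∀ (i : Fin n) (α : ℝ), 0 < α →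
    x + EuclideanSpace.single i α ∈ cube n → y + EuclideanSpace.single i α ∈ cube n →
    F (x + EuclideanSpace.single i α) - F x ≤ F (y + EuclideanSpace.single i α) - F y

/-- The gradient of a function on `[0,1]ⁿ` (one-sided derivatives at the boundary). -/
noncomputable def grad {n : ℕ} (F : Vec n → ℝ) (x : Vec n) : Vec n :=
  gradientWithin F (cube n) x

/-- A non-negative differentiable DR-submodular function `F : [0,1]ⁿ → ℝ` that is `G`-Lipschitz,
and `β`-smooth on `K` (its gradient is `β`-Lipschitz there). -/
structure IsReward {n : ℕ} (K : Set (Vec n)) (G β : ℝ) (F : Vec n → ℝ) : Prop where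
  nonneg : ∀ x ∈ cube n, 0 ≤ F x
  dr : DRSubmodular F
  differentiable : DifferentiableOn ℝ F (cube n)
  lipschitz : ∀ x ∈ cube n, ∀ y ∈ cube n, |F x - F y| ≤ G * ‖x - y‖
  smooth : ∀ x ∈ K, ∀ y ∈ K, ‖grad F x - grad F y‖ ≤ β * ‖x - y‖

/-! ### Discretization and lifting -/

/-- The lattice `{0, 1/M, 2/M, …, 1}ⁿ`. -/
def lattice (n M : ℕ) : Set (Vec n) := {x | ∀ i, ∃ j : ℕ, j ≤ M ∧ x i = (j : ℝ) / M}

/-- Rounding of every coordinate down to a multiple of `1/M`. -/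
noncomputable def roundDown {n : ℕ} (M : ℕ) (c : Vec n) : Vec n :=
  WithLp.toLp 2 fun i => (⌊(M : ℝ) * c i⌋₊ : ℝ) / M

/-- The lifting map: if `x i = l / M`, the `i`-th block of the image consists of `l` ones
followed by `M - l` zeros. -/
noncomputable def lift {n : ℕ} (M : ℕ) (x : Vec n) : LVec n M :=
  WithLp.toLp 2 fun p => if ((p.2 : ℕ) : ℝ) + 1 ≤ M * x p.1 then 1 else 0

/-- The lifted lattice points of `K`. -/
def liftedSet {n : ℕ} (M : ℕ) (K : Set (Vec n)) : Set (LVec n M) := lift M '' (K ∩ lattice n M)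

/-- The polytope spanned by the lifted lattice points of `K`. -/
def polytope {n : ℕ} (M : ℕ) (K : Set (Vec n)) : Set (LVec n M) := convexHull ℝ (liftedSet M K)

/-- The lifted linear reward `ã ∘ (1 - 1_C)` where `ã (i, j) = a i / M` and `1_C` is the lift of
the rounded-down vector `c`. -/
noncomputable def liftedReward {n : ℕ} (M : ℕ) (a c : Vec n) : LVec n M :=
  WithLp.toLp 2 fun p => a p.1 / M * (1 - lift M (roundDown M c) p)

/-- `q` is the Euclidean projection of `p` on `C`. -/
def IsProj {E : Type*} [PseudoMetricSpace E] (C : Set E) (p q : E) : Prop :=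
  q ∈ C ∧ ∀ z ∈ C, dist p q ≤ dist p z

/-! ### The Meta-Frank-Wolfe iteration of one round

Rounds are `t = 0, …, T - 1` and iterations are `l = 0, …, L - 1`. -/

/-- The iterates `x_0 = 0`, `x_{l+1} = x_l + (1/L) v_l` with `v_l = x_l ∨ u_l - x_l`. -/
noncomputable def iter {n : ℕ} (L : ℕ) (u : ℕ → Vec n) : ℕ → Vec n
  | 0 => 0
  | l + 1 => iter L u l + (1 / (L : ℝ)) • (vee (iter L u l) (u l) - iter L u l)

/-- The averaging weight `2 / (j + 3)^(2/3)` of the `j`-th iteration, `j ≥ 1`. -/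
noncomputable def rho (j : ℕ) : ℝ := 2 / ((j : ℝ) + 3) ^ (2 / 3 : ℝ)

/-- The averaged gradient estimates `d_0 = 0`, `d_{l+1} = (1 - ρ_{l+1}) d_l + ρ_{l+1} g_l`,
where `g_l` is the estimate at `x_l`. -/
noncomputable def avgGrad {n : ℕ} (g : ℕ → Vec n) : ℕ → Vec n
  | 0 => 0
  | l + 1 => (1 - rho (l + 1)) • avgGrad g l + rho (l + 1) • g l

/-! ### The random run of the algorithm -/

/-- The random quantities of a run, for round `t` and oracle (or iteration) `l`:
* `y t l` is the point of the lifted polytope kept by the oracle;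
* `pts t l` lists the `k` lattice points by which the oracle rounds `y t l`;
* `idx t l` is the random index of the chosen point;
* `g t l` is the stochastic gradient at the iterate `x t l`. -/
structure Run (n M k : ℕ) (Ω : Type*) where
  y : ℕ → ℕ → Ω → LVec n M
  pts : ℕ → ℕ → Ω → Fin k → Vec n
  idx : ℕ → ℕ → Ω → Fin k
  g : ℕ → ℕ → Ω → Vec n

namespace Run

variable {n M k : ℕ} {Ω : Type*}

/-- The output of oracle `l` in round `t`. -/
def u (R : Run n M k Ω) (t l : ℕ) (ω : Ω) : Vec n := R.pts t l ω (R.idx t l ω)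

/-- The iterate `x^t_l`; the vector played in round `t` is `x^t_L`. -/
noncomputable def x (R : Run n M k Ω) (L t l : ℕ) (ω : Ω) : Vec n :=
  iter L (fun j => R.u t j ω) l

/-- The averaged gradient estimate; `d t (l + 1)` is the one fed back to oracle `l`. -/
noncomputable def d (R : Run n M k Ω) (t l : ℕ) (ω : Ω) : Vec n :=
  avgGrad (fun j => R.g t j ω) l

/-- The lifted linear reward that oracle `l` derives from its feedback
`⟨d^t_{l+1}, x^t_l ∨ ·⟩` in round `t`. -/
noncomputable def reward (R : Run n M k Ω) (L t l : ℕ) (ω : Ω) : LVec n M :=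
  liftedReward M (R.d t (l + 1) ω) (R.x L t l ω)

/-- The history before the index `idx t l` is drawn. -/
@[reducible] def histIdx (R : Run n M k Ω) (L t l : ℕ) : MeasurableSpace Ω :=
  (⨆ s ≤ t, ⨆ j < L, MeasurableSpace.comap (R.pts s j) inferInstance) ⊔
  (⨆ s < t, ⨆ j < L, (MeasurableSpace.comap (R.idx s j) inferInstance ⊔
    MeasurableSpace.comap (R.g s j) inferInstance)) ⊔
  (⨆ j < l, MeasurableSpace.comap (R.idx t j) inferInstance)

/-- The history before the gradient estimate `g t l` is drawn. -/
@[reducible] def histGrad (R : Run n M k Ω) (L t l : ℕ) : MeasurableSpace Ω :=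
  (⨆ s ≤ t, ⨆ j < L, (MeasurableSpace.comap (R.pts s j) inferInstance ⊔
    MeasurableSpace.comap (R.idx s j) inferInstance)) ⊔
  (⨆ s < t, ⨆ j < L, MeasurableSpace.comap (R.g s j) inferInstance) ⊔
  (⨆ j < l, MeasurableSpace.comap (R.g t j) inferInstance)

/-- Oracle `l` updates by projected gradient ascent with step size `η`, started at an arbitrary
lifted lattice point. -/
def GradientAscent (R : Run n M k Ω) (K : Set (Vec n)) (T L : ℕ) (η : ℝ) (l : ℕ) : Prop :=
  ∀ ω, R.y 0 l ω ∈ liftedSet M K ∧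
    ∀ t, t + 1 < T → IsProj (polytope M K) (R.y t l ω + η • R.reward L t l ω) (R.y (t + 1) l ω)

/-- Oracle `l` updates by some other procedure for online linear optimization over the polytope
(of dimension `n * M`) whose expected regret is at most `c * n * M * G * √T`. -/
def SqrtRegret [MeasurableSpace Ω] (R : Run n M k Ω) (μ : Measure Ω) (K : Set (Vec n))
    (T L : ℕ) (G c : ℝ) (l : ℕ) : Prop :=
  (∀ t < T, ∀ ω, R.y t l ω ∈ polytope M K) ∧
  ∀ z ∈ polytope M K,
    ∑ t ∈ Finset.range T, ∫ ω, inner ℝ (R.reward L t l ω) (z - R.y t l ω) ∂μ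
      ≤ c * n * M * G * √(T : ℝ)

/-- The oracles of the run are the lifted vee-learning oracles with rounding accuracy `1 / √T`:
each `y t l` is approximated by the average of the lifts of `k` lattice points of `K`, and one of
these points is output, chosen uniformly and independently of the history. The update is
gradient ascent (with the step size `diameter / (reward bound * √T)`, the diameter of the polytope
being at most `√(n M)` and the rewards being bounded by `G`), or another procedure with regret
of order `√T`. -/
structure VeeOracles [MeasurableSpace Ω] (R : Run n M k Ω) (μ : Measure Ω) (K : Set (Vec n))
    (T L : ℕ) (G c : ℝ) : Prop where
  measurable_y : ∀ t < T, ∀ l < L, Measurable (R.y t l)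
  measurable_pts : ∀ t < T, ∀ l < L, Measurable (R.pts t l)
  measurable_idx : ∀ t < T, ∀ l < L, Measurable (R.idx t l)
  pts_mem : ∀ t < T, ∀ l < L, ∀ ω j, R.pts t l ω j ∈ K ∩ lattice n M
  round : ∀ t < T, ∀ l < L, ∀ ω,
    ‖R.y t l ω - (1 / (k : ℝ)) • ∑ j, lift M (R.pts t l ω j)‖ ≤ 1 / √(T : ℝ)
  uniform : ∀ t < T, ∀ l < L, ∀ j, μ (R.idx t l ⁻¹' {j}) = (k : ENNReal)⁻¹
  indep : ∀ t < T, ∀ l < L,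
    Indep (MeasurableSpace.comap (R.idx t l) inferInstance) (R.histIdx L t l) μ
  update : ∀ l < L,
    R.GradientAscent K T L (√((n : ℝ) * M) / (G * √(T : ℝ))) l ∨ R.SqrtRegret μ K T L G c l

/-- The gradient estimates are unbiased given the history, with variance at most `σ²`. -/
structure StochasticGradients [MeasurableSpace Ω] (R : Run n M k Ω) (μ : Measure Ω)
    (F : ℕ → Vec n → ℝ) (T L : ℕ) (σ : ℝ) : Prop where
  measurable_g : ∀ t < T, ∀ l < L, Measurable (R.g t l)
  memLp : ∀ t < T, ∀ l < L, MemLp (R.g t l) 2 μ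
  unbiased : ∀ t < T, ∀ l < L,
    μ[R.g t l | R.histGrad L t l] =ᵐ[μ] fun ω => grad (F t) (R.x L t l ω)
  variance : ∀ t < T, ∀ l < L,
    ∫ ω, ‖R.g t l ω - grad (F t) (R.x L t l ω)‖ ^ 2 ∂μ ≤ σ ^ 2

end Run

/-- The number of lattice steps per coordinate, `(T/n)^(1/4)` rounded up. -/
noncomputable def latticeParam (n T : ℕ) : ℕ := ⌈((T : ℝ) / n) ^ (1 / 4 : ℝ)⌉₊

end OnlineDR

/-!
The iterates of one round satisfy `x_{l+1} - x_l = (1 / L) v_l` with `v_l = (u_l - x_l)⁺ ∈ K`, and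
`x_l` has coordinates at most `1 - q ^ l`, where `q = 1 - 1 / L`. A DR-submodular function is
concave along non-negative directions, whence `⟨∇F(x_l), (x* - x_l)⁺⟩ ≥ F(x_l ∨ x*) - F(x_l)`, and it
satisfies `F(x_l ∨ x*) ≥ q ^ l F(x*)` (`mul_le_vee`). If the oracles compete with `x*` up to errors
`e_l`, this gives `a_{l+1} - a_l ≥ (q ^ l A - a_l - e_l) / L` for the expected values
`a_l = ∑ E F(x_l)` and `A = ∑ F(x*)`, so that `a_L ≥ q ^ (L - 1) A - (1 / L) ∑ e_l`, and
`q ^ (L - 1) ≥ 1 / e` (`frankWolfe_unroll`).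

The errors `e_l` are of three kinds (`IsReward.progress`).
* Rounding. Pairing a lifted reward with a lifted lattice point `z` gives `⟨a, c̄ ∨ z - c̄⟩`
  (`inner_liftedReward_lift`), so that passing to the lattice costs `G √n / M` per round. The random
  choice of a lattice point is unbiased for the lifted reward of the exact gradient, because that
  gradient is determined before the index is drawn (`Setting.integral_rounding`).
* Regret of the oracle, which sees the averaged estimate `d` in place of the gradient
  (`Setting.regret_le`). For gradient ascent the second moment of `d` matters, which is of order
  `G²` on average over `l` once `σ ≤ G L^(1/3)`; for larger `σ` the Lipschitz condition alone suffices.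
* The difference `d - ∇F(x_l)`, which is tested only against vectors of `K - K` and hence costs at
  most `2 D ‖d - ∇F(x_l)‖`. It is the sum of averaged noise, whose variance is of the order of the
  weight `ρ_l` (`integral_norm_avgGrad_noise_sq_le`), and of a lag, whose sum over `l` is at most
  `1 / ρ_L` times `2 G` plus the total variation `S` of the gradients along the iterates
  (`sum_norm_avgGrad_sub_le`).

The two bounds of the theorem arise from two bounds on `S`. Smoothness on `K` gives `S ≤ β D`. On
the other hand the iterates increase, so by the diminishing-returns property every coordinate of the
gradient decreases, and its total variation telescopes to `S ≤ 4 G √n` (`sum_norm_grad_sub_le`);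
this is why `β` is absent from the second bound.
-/

namespace OnlineDR

/-! ### Differentiable DR-submodular functions on the cube -/

section Analysis

variable {n : ℕ}

lemma convex_cube : Convex ℝ (cube n) := by
  intro x hx y hy a b ha hb hab i
  have h1 := hx i
  have h2 := hy i
  simp only [PiLp.add_apply, PiLp.smul_apply, smul_eq_mul]
  constructor
  · exact add_nonneg (mul_nonneg ha h1.1) (mul_nonneg hb h2.1)
  · nlinarith

lemma inner_eq_sum (x y : Vec n) : inner ℝ x y = ∑ i, x i * y i := by
  simp [PiLp.inner_apply, mul_comm]

lemma segment_mem_cube {p q : Vec n} (hp : p ∈ cube n) (hq : q ∈ cube n) {s : ℝ}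
    (hs : s ∈ Set.Icc (0 : ℝ) 1) : p + s • (q - p) ∈ cube n :=
  convex_cube.add_smul_sub_mem hp hq hs

variable {F : Vec n → ℝ}

lemma hasDerivWithinAt_segment (hF : DifferentiableOn ℝ F (cube n)) {p q : Vec n}
    (hp : p ∈ cube n) (hq : q ∈ cube n) {s : ℝ} (hs : s ∈ Set.Icc (0 : ℝ) 1) :
    HasDerivWithinAt (fun r : ℝ => F (p + r • (q - p)))
      (inner ℝ (grad F (p + s • (q - p))) (q - p)) (Set.Icc 0 1) s := by
  have h1 := (hF _ (segment_mem_cube hp hq hs)).hasGradientWithinAt.hasFDerivWithinAt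
  have h2 : HasDerivWithinAt (fun r : ℝ => p + r • (q - p)) (q - p) (Set.Icc 0 1) s := by
    have := ((hasDerivWithinAt_id s (Set.Icc (0 : ℝ) 1)).smul_const (q - p)).const_add p
    simpa using this
  have h3 := h1.comp_hasDerivWithinAt s h2 (fun r hr => segment_mem_cube hp hq hr)
  exact h3.congr_deriv (by simp [grad])

/-- The difference quotient at the left end of a segment converges to the directional
derivative; no interior point is needed. -/
lemma tendsto_slope_segment (hF : DifferentiableOn ℝ F (cube n)) {p q : Vec n}
    (hp : p ∈ cube n) (hq : q ∈ cube n) :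
    Filter.Tendsto (fun s : ℝ => s⁻¹ * (F (p + s • (q - p)) - F p))
      (nhdsWithin 0 (Set.Ioc 0 1)) (nhds (inner ℝ (grad F p) (q - p))) := by
  have h := hasDerivWithinAt_segment hF hp hq (s := 0) (by simp)
  rw [hasDerivWithinAt_iff_tendsto_slope] at h
  have e : Set.Icc (0 : ℝ) 1 \ {0} = Set.Ioc 0 1 := by
    ext r
    simp only [Set.mem_sdiff, Set.mem_Icc, Set.mem_singleton_iff, Set.mem_Ioc]
    constructor
    · rintro ⟨⟨h1, h2⟩, h3⟩
      exact ⟨lt_of_le_of_ne h1 (Ne.symm h3), h2⟩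
    · rintro ⟨h1, h2⟩
      exact ⟨⟨h1.le, h2⟩, h1.ne'⟩
  rw [e] at h
  simpa [slope_fun_def, Function.comp_def] using h

lemma neBot_nhdsWithin_Ioc : (nhdsWithin (0 : ℝ) (Set.Ioc 0 1)).NeBot := by
  rw [nhdsWithin_Ioc_eq_nhdsGT (zero_lt_one)]
  infer_instance

lemma inner_grad_le {G : ℝ} (hF : DifferentiableOn ℝ F (cube n))
    (hG : ∀ x ∈ cube n, ∀ y ∈ cube n, |F x - F y| ≤ G * ‖x - y‖) {p q : Vec n}
    (hp : p ∈ cube n) (hq : q ∈ cube n) : |inner ℝ (grad F p) (q - p)| ≤ G * ‖q - p‖ := by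
  have := neBot_nhdsWithin_Ioc
  refine le_of_tendsto (tendsto_slope_segment hF hp hq).abs ?_
  filter_upwards [self_mem_nhdsWithin] with s hs
  have h := hG _ (segment_mem_cube hp hq ⟨hs.1.le, hs.2⟩) p hp
  rw [abs_mul, abs_inv, abs_of_pos hs.1, inv_mul_le_iff₀ hs.1]
  refine h.trans (le_of_eq ?_)
  rw [add_sub_cancel_left, norm_smul, Real.norm_of_nonneg hs.1.le]
  ring

/-- The part of the gradient on a set of coordinates along which one can move, inside the cube,
with `F` varying to first order with the constant sign `τ`, has norm at most `G`. -/
lemma sum_sq_grad_le {G : ℝ} (hG0 : 0 ≤ G) (hF : DifferentiableOn ℝ F (cube n))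
    (hG : ∀ x ∈ cube n, ∀ y ∈ cube n, |F x - F y| ≤ G * ‖x - y‖) {p : Vec n}
    (hp : p ∈ cube n) (P : Finset (Fin n)) (τ : ℝ)
    (hP : ∀ i ∈ P, (if p i ≤ 1 / 2 then |grad F p i| else -|grad F p i|) * grad F p i
      = τ * (grad F p i) ^ 2) (hτ : |τ| = 1) :
    ∑ i ∈ P, (grad F p i) ^ 2 ≤ G ^ 2 := by
  classical
  set a := grad F p with ha
  -- Steps of length at most `1 / 2` towards the farther face of the cube stay inside it.
  set ε : ℝ := 1 / (2 * (1 + ‖a‖)) with hε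
  have hεpos : 0 < ε := by positivity
  have hsmall : ∀ i, ε * |a i| ≤ 1 / 2 := by
    intro i
    have h1 : |a i| ≤ ‖a‖ := by simpa using PiLp.norm_apply_le a i
    rw [hε, div_mul_eq_mul_div, div_le_div_iff₀ (by positivity) (by norm_num)]
    linarith
  let v : Vec n := WithLp.toLp 2 fun i =>
    if i ∈ P then ε * (if p i ≤ 1 / 2 then |a i| else -|a i|) else 0
  have hv : p + v ∈ cube n := by
    intro i
    have h1 := hp i
    have h2 := hsmall i
    have h3 : 0 ≤ ε * |a i| := by positivity
    simp only [PiLp.add_apply, v]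
    split_ifs <;> constructor <;> linarith
  have h := inner_grad_le hF hG hp hv
  rw [add_sub_cancel_left] at h
  set s := ∑ i ∈ P, (a i) ^ 2 with hs
  have hs0 : 0 ≤ s := Finset.sum_nonneg fun i _ => sq_nonneg _
  have h1 : inner ℝ a v = ε * τ * s := by
    rw [inner_eq_sum, hs, Finset.mul_sum, ← Finset.sum_subset (Finset.subset_univ P)]
    · refine Finset.sum_congr rfl fun i hi => ?_
      simp only [v, if_pos hi]
      rw [mul_assoc, ← hP i hi]
      ring
    · intro i _ hi
      simp [v, hi]
  have h2 : ‖v‖ = ε * √s := by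
    rw [EuclideanSpace.norm_eq, ← Real.sqrt_sq hεpos.le, ← Real.sqrt_mul (sq_nonneg _)]
    congr 1
    rw [hs, Finset.mul_sum, ← Finset.sum_subset (Finset.subset_univ P)]
    · refine Finset.sum_congr rfl fun i hi => ?_
      simp only [v, if_pos hi, Real.norm_eq_abs, sq_abs]
      split_ifs <;> simp [mul_pow]
    · intro i _ hi
      simp [v, hi]
  rw [h1, h2, abs_mul, abs_mul, hτ, abs_of_pos hεpos, abs_of_nonneg hs0] at h
  have h3 : s ≤ G * √s := by
    have : ε * s ≤ ε * (G * √s) := by linarith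
    exact le_of_mul_le_mul_left this hεpos
  have h4 : √s ^ 2 = s := Real.sq_sqrt hs0
  have h5 : √s ≤ G := by
    by_contra hc
    push Not at hc
    have h6 : 0 < √s := lt_of_le_of_lt hG0 hc
    nlinarith
  nlinarith [Real.sqrt_nonneg s]

/-- On the boundary of the cube only one-sided directional derivatives are controlled by the
Lipschitz constant. Splitting the coordinates by the sign of the increment of `F` along an inward
direction bounds the gradient up to a factor `2`. -/
lemma norm_grad_le {G : ℝ} (hG0 : 0 ≤ G) (hF : DifferentiableOn ℝ F (cube n))
    (hG : ∀ x ∈ cube n, ∀ y ∈ cube n, |F x - F y| ≤ G * ‖x - y‖) {p : Vec n}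
    (hp : p ∈ cube n) : ‖grad F p‖ ≤ 2 * G := by
  classical
  set a := grad F p with ha
  let P : Finset (Fin n) := Finset.univ.filter fun i =>
    (if p i ≤ 1 / 2 then |a i| else -|a i|) * a i = 1 * (a i) ^ 2
  have h1 : ∑ i ∈ P, (a i) ^ 2 ≤ G ^ 2 :=
    sum_sq_grad_le hG0 hF hG hp P 1 (fun i hi => (Finset.mem_filter.1 hi).2) (by simp)
  have h2 : ∑ i ∈ Pᶜ, (a i) ^ 2 ≤ G ^ 2 := by
    refine sum_sq_grad_le hG0 hF hG hp Pᶜ (-1) (fun i hi => ?_) (by simp)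
    have hi' : ¬ ((if p i ≤ 1 / 2 then |a i| else -|a i|) * a i = 1 * (a i) ^ 2) := by
      simpa [P] using hi
    rw [← ha]
    rcases abs_choice (a i) with h | h <;> rw [h] at hi' ⊢ <;> split_ifs at hi' ⊢ <;>
      first
      | exact absurd (by ring1) hi'
      | ring1
  have h3 : ‖a‖ ^ 2 ≤ 2 * G ^ 2 := by
    rw [EuclideanSpace.norm_sq_eq, ← Finset.sum_add_sum_compl P]
    simp only [Real.norm_eq_abs, sq_abs]
    linarith
  exact abs_le_of_sq_le_sq' (by nlinarith) (by positivity) |>.2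

lemma inner_single_eq {x : Vec n} {i : Fin n} {a : ℝ} :
    inner ℝ x (EuclideanSpace.single i a) = x i * a := by
  simp [EuclideanSpace.inner_single_right, mul_comm]

lemma grad_le_of_add {x y : Vec n} (hF : DifferentiableOn ℝ F (cube n)) (hdr : DRSubmodular F)
    (hx : x ∈ cube n) (hy : y ∈ cube n) (hxy : ∀ j, x j ≤ y j) {i : Fin n} {a : ℝ} (ha : 0 < a)
    (hx' : x + EuclideanSpace.single i a ∈ cube n) (hy' : y + EuclideanSpace.single i a ∈ cube n) :
    grad F y i ≤ grad F x i := by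
  have h1 := tendsto_slope_segment hF hx hx'
  have h2 := tendsto_slope_segment hF hy hy'
  have := neBot_nhdsWithin_Ioc
  have h3 := le_of_tendsto_of_tendsto h2 h1 (by
    filter_upwards [self_mem_nhdsWithin] with s hs
    have e1 := segment_mem_cube hx hx' ⟨hs.1.le, hs.2⟩
    have e2 := segment_mem_cube hy hy' ⟨hs.1.le, hs.2⟩
    rw [add_sub_cancel_left] at e1 e2 ⊢
    rw [add_sub_cancel_left]
    have e3 : s • EuclideanSpace.single i a = EuclideanSpace.single i (s * a) := by
      ext j; simp [PiLp.single_apply]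
    rw [e3] at e1 e2 ⊢
    exact mul_le_mul_of_nonneg_left (hdr y hy x hx hxy i (s * a) (mul_pos hs.1 ha) e2 e1)
      (inv_nonneg.2 hs.1.le))
  rw [add_sub_cancel_left, add_sub_cancel_left, inner_single_eq, inner_single_eq] at h3
  exact le_of_mul_le_mul_right h3 ha

lemma grad_le_of_sub {x y : Vec n} (hF : DifferentiableOn ℝ F (cube n)) (hdr : DRSubmodular F)
    (hx : x ∈ cube n) (hy : y ∈ cube n) (hxy : ∀ j, x j ≤ y j) {i : Fin n} {a : ℝ} (ha : 0 < a)
    (hx' : x - EuclideanSpace.single i a ∈ cube n) (hy' : y - EuclideanSpace.single i a ∈ cube n) :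
    grad F y i ≤ grad F x i := by
  have h1 := tendsto_slope_segment hF hx hx'
  have h2 := tendsto_slope_segment hF hy hy'
  have := neBot_nhdsWithin_Ioc
  have h3 := le_of_tendsto_of_tendsto h1 h2 (by
    filter_upwards [self_mem_nhdsWithin] with s hs
    have e1 := segment_mem_cube hx hx' ⟨hs.1.le, hs.2⟩
    have e2 := segment_mem_cube hy hy' ⟨hs.1.le, hs.2⟩
    have e3 : ∀ z : Vec n, z + s • (z - EuclideanSpace.single i a - z)
        = z - EuclideanSpace.single i (s * a) := by
      intro z; ext j; simp [PiLp.single_apply]; split_ifs <;> ring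
    rw [e3] at e1 e2 ⊢
    rw [e3]
    have h := hdr _ e2 _ e1 (fun j => by simpa using hxy j) i (s * a) (mul_pos hs.1 ha)
      (by simpa using hy) (by simpa using hx)
    simp only [sub_add_cancel] at h
    refine mul_le_mul_of_nonneg_left ?_ (inv_nonneg.2 hs.1.le)
    linarith)
  rw [sub_sub_cancel_left, sub_sub_cancel_left, inner_neg_right, inner_neg_right,
    inner_single_eq, inner_single_eq] at h3
  exact le_of_mul_le_mul_right (neg_le_neg_iff.1 h3) ha

/-- The gradient of a differentiable DR-submodular function is antitone, up to the boundary. -/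
lemma grad_antitone {x y : Vec n} (hF : DifferentiableOn ℝ F (cube n)) (hdr : DRSubmodular F)
    (hx : x ∈ cube n) (hy : y ∈ cube n) (hxy : ∀ j, x j ≤ y j) (i : Fin n) :
    grad F y i ≤ grad F x i := by
  have hmem : ∀ z ∈ cube n, ∀ a : ℝ, 0 ≤ z i + a → z i + a ≤ 1 →
      z + EuclideanSpace.single i a ∈ cube n := by
    intro z hz a h1 h2 j
    simp only [PiLp.add_apply, PiLp.single_apply]
    by_cases h : j = i
    · subst h; simpa using ⟨h1, h2⟩
    · simpa [h] using hz j
  have hneg : ∀ a : ℝ, EuclideanSpace.single i (-a) = - (EuclideanSpace.single i a : Vec n) := by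
    intro a; ext j; simp [PiLp.single_apply]; split_ifs <;> simp
  have key : ∀ x ∈ cube n, ∀ y ∈ cube n, (∀ j, x j ≤ y j) → (y i < 1 ∨ 0 < x i) →
      grad F y i ≤ grad F x i := by
    intro x hx y hy hxy h
    rcases h with h | h
    · refine grad_le_of_add hF hdr hx hy hxy (a := 1 - y i) (by linarith) ?_ ?_
      · exact hmem x hx _ (by linarith [(hx i).1]) (by linarith [hxy i])
      · exact hmem y hy _ (by linarith [(hy i).1]) (by linarith)
    · refine grad_le_of_sub hF hdr hx hy hxy h ?_ ?_
      · rw [sub_eq_add_neg, ← hneg]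
        exact hmem x hx _ (by linarith) (by linarith [(hx i).2])
      · rw [sub_eq_add_neg, ← hneg]
        exact hmem y hy _ (by linarith [hxy i]) (by linarith [(hy i).2])
  by_cases h : y i < 1 ∨ 0 < x i
  · exact key x hx y hy hxy h
  · push Not at h
    have hx0 : x i = 0 := le_antisymm h.2 (hx i).1
    have hy1 : y i = 1 := le_antisymm (hy i).2 h.1
    -- Opposite faces share no one-sided direction: compare both with a point between them.
    have hz := hmem x hx (1 / 2) (by rw [hx0]; norm_num) (by rw [hx0]; norm_num)
    have hxz : ∀ j, x j ≤ (x + EuclideanSpace.single i (1 / 2 : ℝ) : Vec n) j := by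
      intro j
      simp only [PiLp.add_apply, PiLp.single_apply]
      split_ifs <;> norm_num
    have hzy : ∀ j, (x + EuclideanSpace.single i (1 / 2 : ℝ) : Vec n) j ≤ y j := by
      intro j
      simp only [PiLp.add_apply, PiLp.single_apply]
      split_ifs with hj
      · rw [hj, hx0, hy1]; norm_num
      · simpa using hxy j
    refine (key _ hz y hy hzy (Or.inr ?_)).trans (key x hx _ hz hxz (Or.inl ?_))
    · simp [hx0]
    · simp [hx0]; norm_num

lemma inner_mono_left {a b v : Vec n} (hab : ∀ i, a i ≤ b i) (hv : ∀ i, 0 ≤ v i) :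
    inner ℝ a v ≤ inner ℝ b v := by
  rw [inner_eq_sum, inner_eq_sum]
  exact Finset.sum_le_sum fun i _ => mul_le_mul_of_nonneg_right (hab i) (hv i)

/-- A DR-submodular function is concave along non-negative directions. -/
lemma inner_grad_le_sub_le_inner_grad {x y : Vec n} (hF : DifferentiableOn ℝ F (cube n))
    (hdr : DRSubmodular F) (hx : x ∈ cube n) (hy : y ∈ cube n) (hxy : ∀ j, x j ≤ y j) :
    inner ℝ (grad F y) (y - x) ≤ F y - F x ∧ F y - F x ≤ inner ℝ (grad F x) (y - x) := by
  obtain ⟨s, hs, he⟩ := exists_hasDerivAt_eq_slope (fun r : ℝ => F (x + r • (y - x)))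
    (fun s => inner ℝ (grad F (x + s • (y - x))) (y - x)) zero_lt_one
    (fun r hr => (hasDerivWithinAt_segment hF hx hy hr).continuousWithinAt)
    (fun r hr => (hasDerivWithinAt_segment hF hx hy ⟨hr.1.le, hr.2.le⟩).hasDerivAt
      (Icc_mem_nhds hr.1 hr.2))
  have he' : inner ℝ (grad F (x + s • (y - x))) (y - x) = F y - F x := by
    simpa using he
  have hz := segment_mem_cube hx hy ⟨hs.1.le, hs.2.le⟩
  have hd : ∀ j, 0 ≤ (y - x) j := fun j => by simpa using hxy j
  rw [← he']
  constructor
  · refine inner_mono_left (grad_antitone hF hdr hz hy fun j => ?_) hd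
    have := hxy j
    simp only [PiLp.add_apply, PiLp.smul_apply, PiLp.sub_apply, smul_eq_mul]
    nlinarith [hs.2]
  · refine inner_mono_left (grad_antitone hF hdr hx hz fun j => ?_) hd
    have := hxy j
    simp only [PiLp.add_apply, PiLp.smul_apply, PiLp.sub_apply, smul_eq_mul]
    nlinarith [hs.1]

lemma vee_mem_cube {x y : Vec n} (hx : x ∈ cube n) (hy : y ∈ cube n) : vee x y ∈ cube n :=
  fun i => ⟨le_max_of_le_left (hx i).1, max_le (hx i).2 (hy i).2⟩

/-- The loss of value caused by joining `y` with a point whose coordinates are at most `1 - q`: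
the ray from `y` through `x ∨ y` can be continued inside the cube by the factor `1 / (1 - q)`,
and `F` is concave and non-negative on it. -/
lemma mul_le_vee {x y : Vec n} (hF : DifferentiableOn ℝ F (cube n))
    (hdr : DRSubmodular F) (h0 : ∀ x ∈ cube n, 0 ≤ F x) (hx : x ∈ cube n) (hy : y ∈ cube n)
    {q : ℝ} (hq0 : 0 ≤ q) (hq1' : q ≤ 1) (hq : ∀ i, x i ≤ 1 - q) : q * F y ≤ F (vee x y) := by
  have hw := vee_mem_cube hx hy
  rcases eq_or_lt_of_le hq0 with rfl | hq0'
  · simpa using h0 _ hw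
  rcases le_or_gt 1 q with hq1 | hq1
  · have hveq : vee x y = y := by
      ext i
      have h1 := hq i
      have h2 := (hx i).1
      have h3 := (hy i).1
      simp only [vee]
      exact max_eq_right (by linarith)
    rw [hveq]
    have hq' : q = 1 := le_antisymm hq1' hq1
    simp [hq']
  set θ : ℝ := 1 - q with hθ
  have hθ0 : 0 < θ := by linarith
  let z : Vec n := y + (1 / θ) • (vee x y - y)
  have hz : z ∈ cube n := by
    intro i
    have h1 := hq i
    have h2 := hx i
    have h3 := hy i
    simp only [z, vee, PiLp.add_apply, PiLp.smul_apply, PiLp.sub_apply, smul_eq_mul]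
    rcases le_total (x i) (y i) with h | h
    · rw [max_eq_right h]; simpa using h3
    · rw [max_eq_left h]
      have h4 : 0 ≤ 1 / θ * (x i - y i) := mul_nonneg (by positivity) (by linarith)
      refine ⟨by linarith, ?_⟩
      rw [div_mul_eq_mul_div, one_mul, ← le_sub_iff_add_le', div_le_iff₀ hθ0]
      nlinarith
  have hyw : ∀ j, y j ≤ vee x y j := fun j => le_max_right _ _
  have hwz : ∀ j, vee x y j ≤ z j := by
    intro j
    have h1 := hyw j
    have h2 : 1 ≤ 1 / θ := by rw [le_div_iff₀ hθ0]; linarith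
    simp only [z, PiLp.add_apply, PiLp.smul_apply, PiLp.sub_apply, smul_eq_mul]
    nlinarith
  have e1 := (inner_grad_le_sub_le_inner_grad hF hdr hy hw hyw).1
  have e2 := (inner_grad_le_sub_le_inner_grad hF hdr hw hz hwz).2
  have e3 : z - vee x y = (1 / θ - 1) • (vee x y - y) := by
    simp only [z, sub_smul, one_smul]; abel
  rw [e3, inner_smul_right] at e2
  have e4 := h0 _ hz
  have e5 : (1 / θ - 1) = q / θ := by rw [hθ]; field_simp; ring
  rw [e5] at e2
  have e6 : F z - F (vee x y) ≤ q / θ * (F (vee x y) - F y) :=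
    e2.trans (mul_le_mul_of_nonneg_left e1 (by positivity))
  have e7 : θ * (F z - F (vee x y)) ≤ q * (F (vee x y) - F y) := by
    have := mul_le_mul_of_nonneg_left e6 hθ0.le
    calc _ ≤ _ := this
      _ = _ := by field_simp
  rw [hθ] at e7
  nlinarith

/-- Along an increasing sequence the gradient of a DR-submodular function decreases
coordinate-wise, so its total variation telescopes; no smoothness is involved. -/
lemma sum_norm_grad_sub_le {G : ℝ} (hG0 : 0 ≤ G) (hF : DifferentiableOn ℝ F (cube n))
    (hdr : DRSubmodular F)
    (hG : ∀ x ∈ cube n, ∀ y ∈ cube n, |F x - F y| ≤ G * ‖x - y‖) (x : ℕ → Vec n) (L : ℕ)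
    (hx : ∀ l ≤ L, x l ∈ cube n) (hmono : ∀ l < L, ∀ i, x l i ≤ x (l + 1) i) :
    ∑ l ∈ Finset.range L, ‖grad F (x (l + 1)) - grad F (x l)‖ ≤ 4 * G * √n := by
  have h1 : ∀ v : Vec n, ‖v‖ ≤ ∑ i, |v i| := by
    intro v
    refine abs_le_of_sq_le_sq' ?_ (Finset.sum_nonneg fun i _ => abs_nonneg _) |>.2
    rw [EuclideanSpace.norm_sq_eq]
    exact Finset.sum_sq_le_sq_sum_of_nonneg (fun i _ => abs_nonneg (v i))
  have h2 : ∀ v : Vec n, ∑ i, |v i| ≤ √n * ‖v‖ := by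
    intro v
    refine abs_le_of_sq_le_sq' ?_ (by positivity) |>.2
    rw [mul_pow, Real.sq_sqrt (by positivity), EuclideanSpace.norm_sq_eq]
    simpa using sq_sum_le_card_mul_sum_sq (s := Finset.univ) (f := fun i => |v i|)
  have h3 : ∑ l ∈ Finset.range L, ‖grad F (x (l + 1)) - grad F (x l)‖
      ≤ ∑ l ∈ Finset.range L, ∑ i, (grad F (x l) i - grad F (x (l + 1)) i) := by
    refine Finset.sum_le_sum fun l hl => ?_
    have hl' := Finset.mem_range.1 hl
    rw [norm_sub_rev]
    refine (h1 _).trans (Finset.sum_le_sum fun i _ => ?_)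
    rw [PiLp.sub_apply, abs_of_nonneg]
    exact sub_nonneg.2 (grad_antitone hF hdr (hx l hl'.le) (hx (l + 1) hl') (hmono l hl') i)
  refine h3.trans ?_
  rw [Finset.sum_comm]
  simp_rw [Finset.sum_range_sub' (fun l => grad F (x l) _)]
  have h4 : ∀ v w : Vec n, ∑ i, (v i - w i) ≤ √n * ‖v‖ + √n * ‖w‖ := by
    intro v w
    refine le_trans ?_ (add_le_add (h2 v) (h2 w))
    rw [← Finset.sum_add_distrib]
    refine Finset.sum_le_sum fun i _ => ?_
    linarith [le_abs_self (v i), neg_abs_le (w i)]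
  refine (h4 _ _).trans ?_
  have h5 := norm_grad_le hG0 hF hG (hx 0 (Nat.zero_le _))
  have h6 := norm_grad_le hG0 hF hG (hx L le_rfl)
  nlinarith [Real.sqrt_nonneg (n : ℝ)]

end Analysis

/-! ### Rounding, lifting and the lifted rewards -/

section Lifting

variable {n M : ℕ}

lemma norm_le_norm_of_abs_le {ι : Type*} [Fintype ι] {x y : EuclideanSpace ℝ ι}
    (h : ∀ i, |x i| ≤ |y i|) : ‖x‖ ≤ ‖y‖ := by
  rw [EuclideanSpace.norm_eq, EuclideanSpace.norm_eq]
  refine Real.sqrt_le_sqrt (Finset.sum_le_sum fun i _ => ?_)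
  simp only [Real.norm_eq_abs]
  exact pow_le_pow_left₀ (abs_nonneg _) (h i) 2

lemma norm_le_sqrt_mul {x : Vec n} {b : ℝ} (hb : 0 ≤ b) (h : ∀ i, |x i| ≤ b) :
    ‖x‖ ≤ √n * b := by
  rw [EuclideanSpace.norm_eq, ← Real.sqrt_sq hb, ← Real.sqrt_mul (by positivity)]
  refine Real.sqrt_le_sqrt ((Finset.sum_le_sum (g := fun _ => b ^ 2) fun i _ => ?_).trans ?_)
  · simp only [Real.norm_eq_abs]
    exact pow_le_pow_left₀ (abs_nonneg _) (h i) 2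
  · simp

lemma roundDown_apply (c : Vec n) (i : Fin n) :
    roundDown M c i = (⌊(M : ℝ) * c i⌋₊ : ℝ) / M := rfl

lemma roundDown_nonneg (c : Vec n) (i : Fin n) : 0 ≤ roundDown M c i := by
  rw [roundDown_apply]; positivity

lemma roundDown_le (hM : 1 ≤ M) {c : Vec n} {i : Fin n} (hc : 0 ≤ c i) :
    roundDown M c i ≤ c i := by
  have hM' : (0 : ℝ) < M := by exact_mod_cast hM
  rw [roundDown_apply, div_le_iff₀ hM', mul_comm]
  exact Nat.floor_le (by positivity)

lemma sub_roundDown_le (hM : 1 ≤ M) (c : Vec n) (i : Fin n) :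
    c i - roundDown M c i ≤ 1 / M := by
  have hM' : (0 : ℝ) < M := by exact_mod_cast hM
  rw [roundDown_apply, sub_le_iff_le_add, ← add_div, le_div_iff₀ hM', mul_comm]
  have := Nat.lt_floor_add_one ((M : ℝ) * c i)
  linarith

lemma roundDown_mem {K : Set (Vec n)} (hM : 1 ≤ M) (hK : K ⊆ cube n) (hd : DownClosed K)
    {x : Vec n} (hx : x ∈ K) : roundDown M x ∈ K ∩ lattice n M := by
  refine ⟨hd x hx _ fun i => ⟨roundDown_nonneg x i, roundDown_le hM (hK hx i).1⟩, fun i => ?_⟩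
  refine ⟨⌊(M : ℝ) * x i⌋₊, ?_, rfl⟩
  refine Nat.floor_le_of_le ?_
  have h := (hK hx i).2
  have hM' : (0 : ℝ) ≤ M := by positivity
  nlinarith

/-- The gain vector `c̄ ∨ z - c̄`, where `c̄` is `c` rounded down. Pairing a lifted reward with a
lifted lattice point `z` amounts to pairing the reward vector with this gain. -/
noncomputable def gain (M : ℕ) (c z : Vec n) : Vec n :=
  vee (roundDown M c) z - roundDown M c

lemma gain_apply (c z : Vec n) (i : Fin n) :
    gain M c z i = max (roundDown M c i) (z i) - roundDown M c i := rfl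

/-- A block of the lift meets the complement of another block in `(j - f)⁺` positions. -/
lemma card_block (f j : ℕ) (hj : j ≤ M) :
    ∑ p : Fin M, (1 - if ((p : ℕ) : ℝ) + 1 ≤ f then (1 : ℝ) else 0) *
      (if ((p : ℕ) : ℝ) + 1 ≤ j then (1 : ℝ) else 0) = max (f : ℝ) j - f := by
  have h1 : ∀ p : Fin M, (1 - if ((p : ℕ) : ℝ) + 1 ≤ f then (1 : ℝ) else 0) *
      (if ((p : ℕ) : ℝ) + 1 ≤ j then (1 : ℝ) else 0)
      = (fun q : ℕ => if q ∈ Finset.Ico f j then (1 : ℝ) else 0) p := by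
    intro p
    have e : ∀ b : ℕ, (((p : ℕ) : ℝ) + 1 ≤ b) = ((p : ℕ) < b) := by
      intro b
      rw [← Nat.cast_succ, Nat.cast_le, Nat.succ_le_iff]
    simp only [e, Finset.mem_Ico]
    split_ifs <;> first | (exfalso; omega) | simp
  rw [Finset.sum_congr rfl fun p _ => h1 p,
    Fin.sum_univ_eq_sum_range (fun q : ℕ => if q ∈ Finset.Ico f j then (1 : ℝ) else 0) M,
    Finset.sum_ite_mem, Finset.inter_eq_right.2]
  · rw [Finset.sum_const, Nat.card_Ico, nsmul_eq_mul, mul_one]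
    rcases le_total f j with h | h
    · rw [Nat.cast_sub h, max_eq_right (by exact_mod_cast h)]
    · rw [Nat.sub_eq_zero_of_le h, max_eq_left (by exact_mod_cast h)]; simp
  · intro q hq
    rw [Finset.mem_Ico] at hq
    exact Finset.mem_range.2 (hq.2.trans_le hj)

/-- The lifted reward is linear on the lifted lattice points and reproduces the non-linear reward
`⟨a, c̄ ∨ z - c̄⟩`. -/
lemma inner_liftedReward_lift (hM : 1 ≤ M) (a c : Vec n) {z : Vec n} (hz : z ∈ lattice n M) :
    inner ℝ (liftedReward M a c) (lift M z) = inner ℝ a (gain M c z) := by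
  have hM' : (M : ℝ) ≠ 0 := by positivity
  have h0 : inner ℝ (liftedReward M a c) (lift M z)
      = ∑ p : Fin n × Fin M, liftedReward M a c p * lift M z p := by
    simp [PiLp.inner_apply, mul_comm]
  rw [h0, inner_eq_sum, Fintype.sum_prod_type]
  refine Finset.sum_congr rfl fun i _ => ?_
  obtain ⟨j, hj, hzj⟩ := hz i
  have e1 : (M : ℝ) * z i = j := by rw [hzj]; field_simp
  have e2 : (M : ℝ) * roundDown M c i = (⌊(M : ℝ) * c i⌋₊ : ℕ) := by
    rw [roundDown_apply]; field_simp
  simp only [liftedReward, lift, e1, e2, mul_assoc]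
  rw [← Finset.mul_sum, card_block _ _ hj, gain_apply, ← e1, ← e2,
    ← mul_max_of_nonneg _ _ (by positivity : (0 : ℝ) ≤ M), ← mul_sub]
  field_simp

lemma liftedReward_sub (a b c : Vec n) :
    liftedReward M (a - b) c = liftedReward M a c - liftedReward M b c := by
  ext p
  simp only [liftedReward, PiLp.sub_apply]
  ring

lemma lift_mem_Icc (z : Vec n) (p : Fin n × Fin M) : 0 ≤ lift M z p ∧ lift M z p ≤ 1 := by
  simp only [lift]
  split_ifs <;> simp

lemma norm_liftedReward_sq_le (hM : 1 ≤ M) (a c : Vec n) :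
    ‖liftedReward M a c‖ ^ 2 ≤ ‖a‖ ^ 2 / M := by
  have hM' : (0 : ℝ) < M := by exact_mod_cast hM
  rw [EuclideanSpace.norm_sq_eq, EuclideanSpace.norm_sq_eq, Fintype.sum_prod_type,
    Finset.sum_div]
  refine Finset.sum_le_sum fun i _ => ?_
  have h : ∀ j : Fin M, ‖liftedReward M a c (i, j)‖ ^ 2 ≤ ‖a i‖ ^ 2 / M ^ 2 := by
    intro j
    have h1 := lift_mem_Icc (M := M) (roundDown M c) (i, j)
    simp only [liftedReward, Real.norm_eq_abs, sq_abs, mul_pow, div_pow]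
    refine mul_le_of_le_one_right (by positivity) ?_
    nlinarith
  refine (Finset.sum_le_sum fun j _ => h j).trans (le_of_eq ?_)
  rw [Finset.sum_const, Finset.card_univ, Fintype.card_fin, nsmul_eq_mul]
  field_simp

lemma norm_liftedReward_le (hM : 1 ≤ M) (a c : Vec n) : ‖liftedReward M a c‖ ≤ ‖a‖ := by
  have h := norm_liftedReward_sq_le hM a c
  have hM' : (1 : ℝ) ≤ M := by exact_mod_cast hM
  exact abs_le_of_sq_le_sq' (h.trans (div_le_self (sq_nonneg _) hM')) (norm_nonneg _) |>.2

lemma abs_gain_le (c : Vec n) {z : Vec n} {i : Fin n} (hz : 0 ≤ z i) :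
    |gain M c z i| ≤ |z i| := by
  have h := roundDown_nonneg (M := M) c i
  rw [gain_apply, abs_of_nonneg (sub_nonneg.2 (le_max_left _ _)), abs_of_nonneg hz,
    sub_le_iff_le_add]
  exact max_le (by linarith) (by linarith)

lemma zero_mem {K : Set (Vec n)} (hne : K.Nonempty) (hK : K ⊆ cube n) (hd : DownClosed K) :
    (0 : Vec n) ∈ K := by
  obtain ⟨x, hx⟩ := hne
  exact hd x hx 0 fun i => ⟨le_rfl, (hK hx i).1⟩

lemma norm_sub_le_sqrt {x y : Vec n} (hx : x ∈ cube n) (hy : y ∈ cube n) : ‖x - y‖ ≤ √n := by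
  rw [← mul_one √(n : ℝ)]
  refine norm_le_sqrt_mul zero_le_one fun i => ?_
  have h1 := hx i
  have h2 := hy i
  rw [PiLp.sub_apply, abs_le]
  constructor <;> linarith

lemma isBounded_of_subset_cube {K : Set (Vec n)} (hK : K ⊆ cube n) : Bornology.IsBounded K :=
  Metric.isBounded_iff.2 ⟨√n, fun x hx y hy => by
    rw [dist_eq_norm]; exact norm_sub_le_sqrt (hK hx) (hK hy)⟩

lemma diam_le_sqrt {K : Set (Vec n)} (hK : K ⊆ cube n) : Metric.diam K ≤ √n :=
  Metric.diam_le_of_forall_dist_le (by positivity) fun x hx y hy => by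
    rw [dist_eq_norm]; exact norm_sub_le_sqrt (hK hx) (hK hy)

lemma norm_sub_le_diam {K : Set (Vec n)} (hK : K ⊆ cube n) {x y : Vec n} (hx : x ∈ K)
    (hy : y ∈ K) : ‖x - y‖ ≤ Metric.diam K := by
  rw [← dist_eq_norm]
  exact Metric.dist_le_diam_of_mem (isBounded_of_subset_cube hK) hx hy

lemma norm_le_diam {K : Set (Vec n)} (hne : K.Nonempty) (hK : K ⊆ cube n) (hd : DownClosed K)
    {x : Vec n} (hx : x ∈ K) : ‖x‖ ≤ Metric.diam K := by
  simpa using norm_sub_le_diam hK hx (zero_mem hne hK hd)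

/-- On the lifted polytope a lifted reward is bounded through the diameter of `K` itself, although
the polytope has a much larger diameter. -/
lemma abs_inner_liftedReward_le {K : Set (Vec n)} (hM : 1 ≤ M) (hne : K.Nonempty)
    (hK : K ⊆ cube n) (hd : DownClosed K) (a c : Vec n) {y : LVec n M} (hy : y ∈ polytope M K) :
    |inner ℝ (liftedReward M a c) y| ≤ ‖a‖ * Metric.diam K := by
  have hconv : Convex ℝ {y : LVec n M |
      |inner ℝ (liftedReward M a c) y| ≤ ‖a‖ * Metric.diam K} := by
    intro y hy z hz s t hs ht hst
    simp only [Set.mem_ofPred_eq, inner_add_right, inner_smul_right] at *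
    refine (abs_add_le _ _).trans ?_
    rw [abs_mul, abs_mul, abs_of_nonneg hs, abs_of_nonneg ht]
    calc _ ≤ s * (‖a‖ * Metric.diam K) + t * (‖a‖ * Metric.diam K) :=
          add_le_add (mul_le_mul_of_nonneg_left hy hs) (mul_le_mul_of_nonneg_left hz ht)
      _ = _ := by rw [← add_mul, hst, one_mul]
  refine convexHull_min ?_ hconv hy
  rintro _ ⟨p, ⟨hpK, hpl⟩, rfl⟩
  simp only [Set.mem_ofPred_eq]
  rw [inner_liftedReward_lift hM a c hpl]
  refine (abs_real_inner_le_norm _ _).trans (mul_le_mul_of_nonneg_left ?_ (norm_nonneg _))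
  exact (norm_le_norm_of_abs_le fun i => abs_gain_le c (hK hpK i).1).trans
    (norm_le_diam hne hK hd hpK)

lemma norm_lift_sub_sq_le (x y : Vec n) : ‖lift M x - lift M y‖ ^ 2 ≤ n * M := by
  rw [EuclideanSpace.norm_sq_eq]
  have h : ∀ p : Fin n × Fin M, ‖(lift M x - lift M y) p‖ ^ 2 ≤ 1 := by
    intro p
    have h1 := lift_mem_Icc x p
    have h2 := lift_mem_Icc y p
    rw [PiLp.sub_apply, Real.norm_eq_abs, sq_abs]
    nlinarith
  refine (Finset.sum_le_sum fun p _ => h p).trans ?_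
  simp

/-- Replacing `c` by its rounding, and `z` by a point `z'`, changes the gain by at most
`√n / M + ‖z - z'‖`. -/
lemma abs_inner_gain_sub_le (hM : 1 ≤ M) (a z y : Vec n) {c : Vec n} (hc : c ∈ cube n) :
    |inner ℝ a (gain M c z) - inner ℝ a (vee c y - c)| ≤ ‖a‖ * (√n * (1 / M) + ‖z - y‖) := by
  rw [← inner_sub_right]
  refine (abs_real_inner_le_norm _ _).trans (mul_le_mul_of_nonneg_left ?_ (norm_nonneg _))
  have e1 : gain M c z - (vee c y - c)
      = (gain M c z - (vee c z - c)) + ((vee c z - c) - (vee c y - c)) := by abel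
  rw [e1]
  refine (norm_add_le _ _).trans (add_le_add ?_ ?_)
  · refine norm_le_sqrt_mul (by positivity) fun i => ?_
    have h1 := roundDown_le hM (hc i).1
    have h2 := sub_roundDown_le hM c i
    simp only [PiLp.sub_apply, gain_apply, vee]
    rw [abs_le]
    rcases max_cases (roundDown M c i) (z i) with h | h <;>
      rcases max_cases (c i) (z i) with h' | h' <;> constructor <;> linarith
  · refine norm_le_norm_of_abs_le fun i => ?_
    simp only [PiLp.sub_apply, vee, sub_sub_sub_cancel_right]
    simpa using abs_max_sub_max_le_max (c i) (z i) (c i) (y i)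

lemma norm_roundDown_sub_le (hM : 1 ≤ M) {y : Vec n} (hy : y ∈ cube n) :
    ‖roundDown M y - y‖ ≤ √n * (1 / M) := by
  refine norm_le_sqrt_mul (by positivity) fun i => ?_
  rw [PiLp.sub_apply, abs_sub_comm, abs_of_nonneg (sub_nonneg.2 (roundDown_le hM (hy i).1))]
  exact sub_roundDown_le hM y i

end Lifting

/-! ### The iterates -/

section Iterates

variable {n : ℕ} {K : Set (Vec n)} {L : ℕ} {u : ℕ → Vec n}

lemma vee_sub_mem (hK : K ⊆ cube n) (hd : DownClosed K) {x y : Vec n} (hx : x ∈ cube n)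
    (hy : y ∈ K) : vee x y - x ∈ K := by
  refine hd y hy _ fun i => ?_
  have h1 := hx i
  have h2 := hK hy i
  simp only [vee, PiLp.sub_apply]
  exact ⟨sub_nonneg.2 (le_max_left _ _), sub_le_iff_le_add.2 (max_le (by linarith) (by linarith))⟩

lemma smul_mem_of_downClosed (hK : K ⊆ cube n) (hd : DownClosed K) {w : Vec n} (hw : w ∈ K)
    {s : ℝ} (hs0 : 0 ≤ s) (hs1 : s ≤ 1) : s • w ∈ K := by
  refine hd w hw _ fun i => ?_
  have h := hK hw i
  simp only [PiLp.smul_apply, smul_eq_mul]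
  exact ⟨mul_nonneg hs0 h.1, mul_le_of_le_one_left h.1 hs1⟩

/-- The iterate `x_l` lies in `(l / L) K`: the joined points may leave `K`, but every increment is
`1 / L` times a point of `K`. -/
lemma iter_eq_smul (hne : K.Nonempty) (hK : K ⊆ cube n) (hc : Convex ℝ K) (hd : DownClosed K)
    (hu : ∀ j < L, u j ∈ K) (l : ℕ) (hl : l ≤ L) :
    ∃ w ∈ K, iter L u l = ((l : ℝ) / L) • w := by
  induction l with
  | zero => exact ⟨0, zero_mem hne hK hd, by simp [iter]⟩
  | succ l ih =>
    obtain ⟨w, hw, he⟩ := ih (by omega)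
    have hL : (0 : ℝ) < L := by exact_mod_cast (by omega : 0 < L)
    have hlL : (l : ℝ) / L ≤ 1 := by
      rw [div_le_one hL]; exact_mod_cast (by omega : l ≤ L)
    have hx : iter L u l ∈ cube n := by
      rw [he]
      exact hK (smul_mem_of_downClosed hK hd hw (by positivity) hlL)
    have hv := vee_sub_mem hK hd hx (hu l (by omega))
    refine ⟨((l : ℝ) / (l + 1)) • w + ((1 : ℝ) / (l + 1)) • (vee (iter L u l) (u l) - iter L u l),
      hc hw hv (by positivity) (by positivity) (by field_simp), ?_⟩
    have e : iter L u (l + 1)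
        = ((l : ℝ) / L) • w + (1 / (L : ℝ)) • (vee (iter L u l) (u l) - iter L u l) := by
      rw [← he]; rfl
    rw [e, smul_add, smul_smul, smul_smul]
    push_cast
    congr 2 <;> field_simp

lemma iter_mem (hne : K.Nonempty) (hK : K ⊆ cube n) (hc : Convex ℝ K) (hd : DownClosed K)
    (hu : ∀ j < L, u j ∈ K) {l : ℕ} (hl : l ≤ L) : iter L u l ∈ K := by
  obtain ⟨w, hw, he⟩ := iter_eq_smul hne hK hc hd hu l hl
  rw [he]
  refine smul_mem_of_downClosed hK hd hw (by positivity) (div_le_one_of_le₀ ?_ (by positivity))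
  exact_mod_cast hl

lemma iter_succ_sub (l : ℕ) :
    iter L u (l + 1) - iter L u l = (1 / (L : ℝ)) • (vee (iter L u l) (u l) - iter L u l) := by
  simp [iter]

lemma iter_le_succ (l : ℕ) (i : Fin n) : iter L u l i ≤ iter L u (l + 1) i := by
  have h : 0 ≤ (iter L u (l + 1) - iter L u l) i := by
    rw [iter_succ_sub]
    simp only [PiLp.smul_apply, PiLp.sub_apply, vee, smul_eq_mul]
    exact mul_nonneg (by positivity) (sub_nonneg.2 (le_max_left _ _))
  simpa using h

lemma norm_iter_succ_sub_le (hne : K.Nonempty) (hK : K ⊆ cube n) (hc : Convex ℝ K)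
    (hd : DownClosed K) (hu : ∀ j < L, u j ∈ K) {l : ℕ} (hl : l < L) :
    ‖iter L u (l + 1) - iter L u l‖ ≤ 1 / L * Metric.diam K := by
  rw [iter_succ_sub, norm_smul, Real.norm_of_nonneg (by positivity)]
  refine mul_le_mul_of_nonneg_left ?_ (by positivity)
  exact norm_le_diam hne hK hd
    (vee_sub_mem hK hd (hK (iter_mem hne hK hc hd hu hl.le)) (hu l hl))

lemma iter_le_one_sub_pow (hL : 1 ≤ L) (hu : ∀ j < L, u j ∈ cube n) (l : ℕ) (hl : l ≤ L)
    (i : Fin n) : iter L u l i ≤ 1 - (1 - 1 / (L : ℝ)) ^ l := by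
  have hL' : (1 : ℝ) ≤ L := by exact_mod_cast hL
  have hq1 : 1 / (L : ℝ) ≤ 1 := by rw [div_le_one (by linarith)]; exact hL'
  have hq0 : 0 ≤ 1 / (L : ℝ) := by positivity
  induction l with
  | zero => simp [iter]
  | succ l ih =>
    have h1 := ih (by omega)
    have h2 : iter L u (l + 1) i
        = iter L u l i + 1 / (L : ℝ) * (max (iter L u l i) (u l i) - iter L u l i) := by
      simp [iter, vee]
    have h4 : 0 ≤ (1 - 1 / (L : ℝ)) ^ l := by
      apply pow_nonneg; linarith
    have h3 : max (iter L u l i) (u l i) ≤ 1 := max_le (by linarith) (hu l (by omega) i).2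
    rw [h2, pow_succ]
    nlinarith

end Iterates

/-! ### The averaged gradient estimates -/

section Averaging

variable {n : ℕ}

lemma rho_pos (j : ℕ) : 0 < rho j := by unfold rho; positivity

lemma rho_antitone : Antitone rho := by
  intro i j hij
  unfold rho
  have h : (i : ℝ) ≤ j := by exact_mod_cast hij
  gcongr

lemma rho_one_le : rho 1 ≤ 1 := by
  unfold rho
  rw [div_le_one (by positivity)]
  have h : ((4 : ℝ) ^ (2 / 3 : ℝ)) ^ (3 : ℕ) = 16 := by
    rw [← Real.rpow_natCast, ← Real.rpow_mul (by norm_num)]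
    norm_num
  have h0 : (0 : ℝ) ≤ 4 ^ (2 / 3 : ℝ) := by positivity
  have e : ((1 : ℕ) : ℝ) + 3 = 4 := by norm_num
  rw [e]
  by_contra hc
  push Not at hc
  have : ((4 : ℝ) ^ (2 / 3 : ℝ)) ^ (3 : ℕ) < 2 ^ 3 := pow_lt_pow_left₀ hc h0 (by norm_num)
  linarith

lemma rho_le_one {j : ℕ} (hj : 1 ≤ j) : rho j ≤ 1 := (rho_antitone hj).trans rho_one_le

lemma inv_rho_le {L : ℕ} (hL : 1 ≤ L) : (rho L)⁻¹ ≤ 2 * (L : ℝ) ^ (2 / 3 : ℝ) := by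
  unfold rho
  have hL' : (1 : ℝ) ≤ L := by exact_mod_cast hL
  have h1 : ((L : ℝ) + 3) ^ (2 / 3 : ℝ) ≤ (4 * L) ^ (2 / 3 : ℝ) := by
    gcongr; linarith
  have h2 : ((4 : ℝ) * L) ^ (2 / 3 : ℝ) ≤ 4 * (L : ℝ) ^ (2 / 3 : ℝ) := by
    rw [Real.mul_rpow (by norm_num) (by positivity)]
    gcongr
    calc (4 : ℝ) ^ (2 / 3 : ℝ) ≤ 4 ^ (1 : ℝ) :=
          Real.rpow_le_rpow_of_exponent_le (by norm_num) (by norm_num)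
      _ = 4 := Real.rpow_one 4
  rw [inv_div]
  linarith

/-- The weights decrease so slowly that `2 ρ` is a supersolution of the variance recursion. -/
lemma rho_recursion (l : ℕ) :
    (1 - rho (l + 1)) * (2 * rho l) + rho (l + 1) ^ 2 ≤ 2 * rho (l + 1) := by
  have hs : (0 : ℝ) < (l : ℝ) + 3 := by positivity
  have h1 := rho_pos (l + 1)
  have h2 : rho (l + 1) ≤ rho l := rho_antitone (Nat.le_succ l)
  have h3 : rho l ≤ rho (l + 1) * (((l : ℝ) + 4) / (l + 3)) := by
    unfold rho
    have e : ((l : ℝ) + 4) ^ (2 / 3 : ℝ) = ((l : ℝ) + 3) ^ (2 / 3 : ℝ)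
        * (((l : ℝ) + 4) / (l + 3)) ^ (2 / 3 : ℝ) := by
      rw [← Real.mul_rpow (by positivity) (by positivity)]
      congr 1
      field_simp
    have h4 : (((l : ℝ) + 4) / (l + 3)) ^ (2 / 3 : ℝ) ≤ ((l : ℝ) + 4) / (l + 3) := by
      calc _ ≤ (((l : ℝ) + 4) / (l + 3)) ^ (1 : ℝ) := by
            refine Real.rpow_le_rpow_of_exponent_le ?_ (by norm_num)
            rw [le_div_iff₀ hs]; linarith
        _ = _ := Real.rpow_one _
    push_cast
    rw [show (l : ℝ) + 1 + 3 = l + 4 by ring, e, div_mul_eq_mul_div,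
      div_le_div_iff₀ (by positivity) (by positivity)]
    have h5 : 0 ≤ ((l : ℝ) + 3) ^ (2 / 3 : ℝ) := by positivity
    nlinarith
  have h4 : 2 / ((l : ℝ) + 3) ≤ rho l := by
    unfold rho
    gcongr
    calc ((l : ℝ) + 3) ^ (2 / 3 : ℝ) ≤ ((l : ℝ) + 3) ^ (1 : ℝ) := by
          refine Real.rpow_le_rpow_of_exponent_le ?_ (by norm_num)
          linarith [(Nat.cast_nonneg l : (0 : ℝ) ≤ l)]
      _ = _ := Real.rpow_one _
  have h5 : 2 * rho l ≤ 2 * rho (l + 1) + rho (l + 1) * rho l := by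
    have e : ((l : ℝ) + 4) / (l + 3) = 1 + 1 / (l + 3) := by field_simp; ring
    rw [e] at h3
    have : rho (l + 1) * (2 / ((l : ℝ) + 3)) ≤ rho (l + 1) * rho l :=
      mul_le_mul_of_nonneg_left h4 h1.le
    have e2 : rho (l + 1) * (2 / ((l : ℝ) + 3)) = 2 * (rho (l + 1) * (1 / (l + 3))) := by ring
    linarith
  nlinarith

lemma sum_rho_le (L : ℕ) :
    ∑ l ∈ Finset.range L, rho (l + 1) ≤ 6 * (L : ℝ) ^ (1 / 3 : ℝ) := by
  induction L with
  | zero => simp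
  | succ L ih =>
    rw [Finset.sum_range_succ]
    set p := ((L + 1 : ℕ) : ℝ) ^ (1 / 3 : ℝ) with hp
    set q := (L : ℝ) ^ (1 / 3 : ℝ) with hq
    have hp0 : 0 < p := by positivity
    have hq0 : 0 ≤ q := by positivity
    have hqp : q ≤ p := by
      rw [hp, hq]; gcongr; exact Nat.le_succ L
    have hp3 : p ^ 3 = L + 1 := by
      rw [hp, ← Real.rpow_natCast, ← Real.rpow_mul (by positivity)]; norm_num
    have hq3 : q ^ 3 = L := by
      rw [hq, ← Real.rpow_natCast, ← Real.rpow_mul (by positivity)]; norm_num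
    have hp2 : ((L + 1 : ℕ) : ℝ) ^ (2 / 3 : ℝ) = p ^ 2 := by
      rw [hp, ← Real.rpow_natCast, ← Real.rpow_mul (by positivity)]; norm_num
    have h1 : rho (L + 1) ≤ 2 / p ^ 2 := by
      rw [← hp2]; unfold rho; gcongr; linarith
    have h2 : 2 / p ^ 2 ≤ 6 * (p - q) := by
      rw [div_le_iff₀ (by positivity)]
      have h3 : (p - q) * (p ^ 2 + p * q + q ^ 2) = 1 := by
        have : (p - q) * (p ^ 2 + p * q + q ^ 2) = p ^ 3 - q ^ 3 := by ring
        rw [this, hp3, hq3]; ring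
      have h4 : p ^ 2 + p * q + q ^ 2 ≤ 3 * p ^ 2 := by nlinarith
      have h5 := mul_le_mul_of_nonneg_left h4 (sub_nonneg.2 hqp)
      linarith
    linarith

lemma avgGrad_succ (f : ℕ → Vec n) (l : ℕ) :
    avgGrad f (l + 1) = (1 - rho (l + 1)) • avgGrad f l + rho (l + 1) • f l := rfl

lemma avgGrad_add (f g : ℕ → Vec n) (l : ℕ) :
    avgGrad (fun j => f j + g j) l = avgGrad f l + avgGrad g l := by
  induction l with
  | zero => simp [avgGrad]
  | succ l ih => rw [avgGrad_succ, avgGrad_succ, avgGrad_succ, ih]; module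

lemma norm_avgGrad_le {f : ℕ → Vec n} {B : ℝ} (hB : 0 ≤ B) (l : ℕ)
    (hf : ∀ j < l, ‖f j‖ ≤ B) : ‖avgGrad f l‖ ≤ B := by
  induction l with
  | zero => simpa [avgGrad] using hB
  | succ l ih =>
    have h1 := ih fun j hj => hf j (by omega)
    have h2 := hf l (by omega)
    have h3 := rho_pos (l + 1)
    have h4 := rho_le_one (Nat.le_add_left 1 l)
    rw [avgGrad_succ]
    refine (norm_add_le _ _).trans ?_
    rw [norm_smul, norm_smul, Real.norm_of_nonneg (by linarith), Real.norm_of_nonneg h3.le]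
    nlinarith

/-- The total lag of the average behind a sequence is controlled by the first value and the total
variation, up to the factor `1 / ρ_L`. -/
lemma sum_norm_avgGrad_sub_le (f : ℕ → Vec n) {L : ℕ} (hL : 1 ≤ L) {B S : ℝ}
    (h0 : ‖f 0‖ ≤ B) (hS : ∑ l ∈ Finset.range L, ‖f (l + 1) - f l‖ ≤ S) :
    ∑ l ∈ Finset.range L, ‖avgGrad f (l + 1) - f l‖ ≤ (B + S) * (rho L)⁻¹ := by
  have hρ := rho_pos L
  have key : ∀ N, N + 1 ≤ L → ∑ l ∈ Finset.range (N + 1), ‖avgGrad f (l + 1) - f l‖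
      ≤ (1 - rho L) * (B + ∑ l ∈ Finset.range N, ‖avgGrad f (l + 1) - f l‖
        + ∑ l ∈ Finset.range N, ‖f (l + 1) - f l‖) := by
    intro N hN
    induction N with
    | zero =>
      simp only [zero_add, Finset.sum_range_one, Finset.sum_range_zero, add_zero]
      have e : avgGrad f 1 - f 0 = -((1 - rho 1) • f 0) := by
        rw [avgGrad_succ f 0]; simp only [avgGrad, zero_add]; module
      have h1 := rho_antitone hL
      have h2 := rho_one_le
      rw [e, norm_neg, norm_smul, Real.norm_of_nonneg (by linarith)]
      have := norm_nonneg (f 0)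
      nlinarith
    | succ N ih =>
      rw [Finset.sum_range_succ, Finset.sum_range_succ _ N, Finset.sum_range_succ _ N]
      have h := ih (by omega)
      rw [Finset.sum_range_succ] at h
      have e : avgGrad f (N + 1 + 1) - f (N + 1)
          = (1 - rho (N + 2)) • ((avgGrad f (N + 1) - f N) - (f (N + 1) - f N)) := by
        rw [avgGrad_succ f (N + 1)]; module
      have h1 : rho L ≤ rho (N + 2) := rho_antitone hN
      have h2 : rho (N + 2) ≤ 1 := rho_le_one (by omega)
      have h3 : ‖avgGrad f (N + 1 + 1) - f (N + 1)‖
          ≤ (1 - rho L) * (‖avgGrad f (N + 1) - f N‖ + ‖f (N + 1) - f N‖) := by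
        rw [e, norm_smul, Real.norm_of_nonneg (by linarith)]
        refine mul_le_mul (by linarith) (norm_sub_le _ _) (norm_nonneg _) (by linarith)
      linarith
  obtain ⟨N, rfl⟩ : ∃ N, L = N + 1 := ⟨L - 1, by omega⟩
  have h := key N le_rfl
  have h1 : ∑ l ∈ Finset.range N, ‖avgGrad f (l + 1) - f l‖
      ≤ ∑ l ∈ Finset.range (N + 1), ‖avgGrad f (l + 1) - f l‖ := by
    rw [Finset.sum_range_succ]; linarith [norm_nonneg (avgGrad f (N + 1) - f N)]
  have h2 : ∑ l ∈ Finset.range N, ‖f (l + 1) - f l‖ ≤ S := by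
    rw [Finset.sum_range_succ] at hS; linarith [norm_nonneg (f (N + 1) - f N)]
  have h3 := rho_le_one hL
  have hB : 0 ≤ B := (norm_nonneg _).trans h0
  have hS0 : 0 ≤ S := (Finset.sum_nonneg fun _ _ => norm_nonneg _).trans h2
  rw [← div_eq_mul_inv, le_div_iff₀ hρ]
  have h4 : 0 ≤ 1 - rho (N + 1) := by linarith
  have h5 := mul_le_mul_of_nonneg_left (add_le_add (add_le_add_right h1 B) h2) h4
  nlinarith

end Averaging

/-! ### Projected gradient ascent -/

section Regret

variable {E : Type*} [NormedAddCommGroup E] [InnerProductSpace ℝ E]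

lemma IsProj.norm_sub_le {C : Set E} (hC : Convex ℝ C) {p q z : E} (h : IsProj C p q)
    (hz : z ∈ C) : ‖z - q‖ ≤ ‖z - p‖ := by
  have h1 : ∀ w ∈ C, inner ℝ (p - q) (w - q) ≤ 0 := by
    refine (norm_eq_iInf_iff_real_inner_le_zero hC h.1).1 (le_antisymm ?_ ?_)
    · have : Nonempty C := ⟨⟨q, h.1⟩⟩
      refine le_ciInf fun w => ?_
      simpa [dist_eq_norm] using h.2 w w.2
    · exact ciInf_le (f := fun w : C => ‖p - w‖) ⟨0, by rintro _ ⟨w, rfl⟩; exact norm_nonneg _⟩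
        ⟨q, h.1⟩
  have h2 := h1 z hz
  have h3 : ‖z - p‖ ^ 2 = ‖z - q‖ ^ 2 - 2 * inner ℝ (p - q) (z - q) + ‖p - q‖ ^ 2 := by
    rw [show z - p = (z - q) - (p - q) by abel, norm_sub_sq_real, real_inner_comm]
  exact abs_le_of_sq_le_sq' (by nlinarith [sq_nonneg ‖p - q‖]) (norm_nonneg _) |>.2

/-- The regret of projected gradient ascent against a fixed comparator. -/
lemma sum_inner_sub_le_of_isProj {C : Set E} (hC : Convex ℝ C) {η : ℝ} (hη : 0 < η)
    (r y : ℕ → E) {z : E} (hz : z ∈ C) (T : ℕ)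
    (h : ∀ t, t + 1 < T → IsProj C (y t + η • r t) (y (t + 1))) :
    ∑ t ∈ Finset.range T, inner ℝ (r t) (z - y t)
      ≤ ‖z - y 0‖ ^ 2 / (2 * η) + η / 2 * ∑ t ∈ Finset.range T, ‖r t‖ ^ 2 := by
  have e : ∀ t, inner ℝ (r t) (z - y t)
      = (‖z - y t‖ ^ 2 - ‖z - (y t + η • r t)‖ ^ 2) / (2 * η) + η / 2 * ‖r t‖ ^ 2 := by
    intro t
    rw [show z - (y t + η • r t) = (z - y t) - η • r t by abel, norm_sub_sq_real (z - y t),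
      inner_smul_right, norm_smul, Real.norm_of_nonneg hη.le, real_inner_comm (r t) (z - y t)]
    field_simp
    ring
  have key : ∀ N, N + 1 ≤ T → ∑ t ∈ Finset.range (N + 1), inner ℝ (r t) (z - y t)
      ≤ (‖z - y 0‖ ^ 2 - ‖z - (y N + η • r N)‖ ^ 2) / (2 * η)
        + η / 2 * ∑ t ∈ Finset.range (N + 1), ‖r t‖ ^ 2 := by
    intro N hN
    induction N with
    | zero => simp [e 0]
    | succ N ih =>
      rw [Finset.sum_range_succ, Finset.sum_range_succ _ (N + 1), e (N + 1), mul_add]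
      have h1 := ih (by omega)
      have h2 := (h N (by omega)).norm_sub_le hC hz
      have h3 : (‖z - y 0‖ ^ 2 - ‖z - (y N + η • r N)‖ ^ 2) / (2 * η)
          + (‖z - y (N + 1)‖ ^ 2 - ‖z - (y (N + 1) + η • r (N + 1))‖ ^ 2) / (2 * η)
          ≤ (‖z - y 0‖ ^ 2 - ‖z - (y (N + 1) + η • r (N + 1))‖ ^ 2) / (2 * η) := by
        rw [← add_div]
        gcongr
        have := pow_le_pow_left₀ (norm_nonneg _) h2 2
        linarith
      linarith
  rcases T with _ | N
  · simp; positivity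
  · refine (key N le_rfl).trans (add_le_add_left ?_ _)
    gcongr
    linarith [sq_nonneg ‖z - (y N + η • r N)‖]

end Regret

/-! ### The Frank-Wolfe recursion -/

lemma one_div_exp_le_pow {L : ℕ} (hL : 1 ≤ L) :
    1 / Real.exp 1 ≤ (1 - 1 / (L : ℝ)) ^ (L - 1) := by
  obtain ⟨N, rfl⟩ : ∃ N, L = N + 1 := ⟨L - 1, by omega⟩
  rcases Nat.eq_zero_or_pos N with rfl | hN
  · simpa using Real.one_le_exp zero_le_one |> inv_le_one_of_one_le₀
  have hN' : (0 : ℝ) < N := by exact_mod_cast hN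
  have e : 1 - 1 / ((N + 1 : ℕ) : ℝ) = (1 + 1 / (N : ℝ))⁻¹ := by
    push_cast; field_simp; ring
  rw [e, Nat.add_sub_cancel, inv_pow, one_div]
  refine inv_anti₀ (by positivity) ?_
  have h := Real.add_one_le_exp (1 / (N : ℝ))
  calc (1 + 1 / (N : ℝ)) ^ N ≤ Real.exp (1 / (N : ℝ)) ^ N :=
        pow_le_pow_left₀ (by positivity) (by linarith) N
    _ = Real.exp 1 := by rw [← Real.exp_nat_mul]; congr 1; field_simp

/-- Unrolling `a_{l+1} ≥ q a_l + (q^l A - e_l) / L` with `q = 1 - 1 / L`: the weights of `A` add up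
to `q^(L-1) ≥ 1 / e`. -/
lemma frankWolfe_unroll {L : ℕ} (hL : 1 ≤ L) {a e : ℕ → ℝ} {A : ℝ} (hA : 0 ≤ A) (h0 : 0 ≤ a 0)
    (he : ∀ l < L, 0 ≤ e l)
    (h : ∀ l < L, (1 / (L : ℝ)) * ((1 - 1 / (L : ℝ)) ^ l * A - a l - e l) ≤ a (l + 1) - a l) :
    1 / Real.exp 1 * A - 1 / (L : ℝ) * ∑ l ∈ Finset.range L, e l ≤ a L := by
  have hL' : (1 : ℝ) ≤ L := by exact_mod_cast hL
  set q := 1 - 1 / (L : ℝ) with hq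
  have hq0 : 0 ≤ q := by
    rw [hq, sub_nonneg, div_le_one (by linarith)]; exact hL'
  have hL0 : 0 ≤ 1 / (L : ℝ) := by positivity
  have hq1 : q ≤ 1 := by rw [hq]; linarith
  have key : ∀ N ≤ L, (N : ℝ) / L * q ^ (N - 1) * A
      - 1 / (L : ℝ) * ∑ l ∈ Finset.range N, e l ≤ a N := by
    intro N hN
    induction N with
    | zero => simpa using h0
    | succ N ih =>
      have h1 := ih (by omega)
      have h2 := h N (by omega)
      have h3 := he N (by omega)
      rw [Finset.sum_range_succ, Nat.add_sub_cancel]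
      have h4 : q * ((N : ℝ) / L * q ^ (N - 1) * A) = (N : ℝ) / L * q ^ N * A := by
        rcases Nat.eq_zero_or_pos N with rfl | hN0
        · simp
        · obtain ⟨m, rfl⟩ : ∃ m, N = m + 1 := ⟨N - 1, by omega⟩
          rw [Nat.add_sub_cancel, pow_succ]; ring
      have h5 : 0 ≤ ∑ l ∈ Finset.range N, e l :=
        Finset.sum_nonneg fun l hl => he l (by have := Finset.mem_range.1 hl; omega)
      have h6 := mul_le_mul_of_nonneg_left h1 hq0
      have h7 : q * (1 / (L : ℝ) * ∑ l ∈ Finset.range N, e l)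
          ≤ 1 / (L : ℝ) * ∑ l ∈ Finset.range N, e l :=
        mul_le_of_le_one_left (mul_nonneg hL0 h5) hq1
      have h8 : ((N + 1 : ℕ) : ℝ) / L * q ^ N * A
          = (N : ℝ) / L * q ^ N * A + 1 / (L : ℝ) * (q ^ N * A) := by
        push_cast; ring
      have h9 : q * a N = a N - 1 / (L : ℝ) * a N := by rw [hq]; ring
      rw [h8]
      linarith
  have h1 := key L le_rfl
  rw [div_self (by linarith), one_mul] at h1
  have h2 := mul_le_mul_of_nonneg_right (one_div_exp_le_pow hL) hA
  linarith

/-! ### Countably-valued random variables -/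

section Countable

variable {Ω α β γ : Type*}

/-- A map with countable range all of whose preimages are measurable. Such maps stay measurable
under composition with arbitrary functions, so that no regularity of the gradient is needed to see
that the gradient at a random lattice-generated iterate is a random variable. -/
def CountablyMeasurable (m : MeasurableSpace Ω) (f : Ω → α) : Prop :=
  (Set.range f).Countable ∧ ∀ s, MeasurableSet[m] (f ⁻¹' s)

variable {m : MeasurableSpace Ω}

lemma countablyMeasurable_of_measurable [MeasurableSpace α] [MeasurableSingletonClass α]
    {f : Ω → α} (hr : (Set.range f).Countable) (hf : Measurable[m] f) :
    CountablyMeasurable m f := by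
  refine ⟨hr, fun s => ?_⟩
  rw [← Set.preimage_inter_range]
  exact hf (hr.mono Set.inter_subset_right).measurableSet

lemma CountablyMeasurable.measurable [MeasurableSpace α] {f : Ω → α}
    (hf : CountablyMeasurable m f) : Measurable[m] f := fun s _ => hf.2 s

lemma CountablyMeasurable.comp₂ {f : Ω → α} {g : Ω → β} (hf : CountablyMeasurable m f)
    (hg : CountablyMeasurable m g) (φ : α → β → γ) :
    CountablyMeasurable m fun ω => φ (f ω) (g ω) := by
  constructor
  · refine ((hf.1.prod hg.1).image fun p => φ p.1 p.2).mono ?_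
    rintro _ ⟨ω, rfl⟩
    exact ⟨(f ω, g ω), ⟨⟨ω, rfl⟩, ⟨ω, rfl⟩⟩, rfl⟩
  · intro s
    have e : (fun ω => φ (f ω) (g ω)) ⁻¹' s
        = ⋃ a ∈ Set.range f, f ⁻¹' {a} ∩ g ⁻¹' {b | φ a b ∈ s} := by
      ext ω
      simp only [Set.mem_preimage, Set.mem_iUnion, Set.mem_inter_iff, Set.mem_singleton_iff,
        Set.mem_ofPred_eq, exists_prop]
      constructor
      · intro h
        exact ⟨f ω, ⟨ω, rfl⟩, rfl, h⟩
      · rintro ⟨a, _, rfl, h⟩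
        exact h
    rw [e]
    exact MeasurableSet.biUnion hf.1 fun a _ => (hf.2 _).inter (hg.2 _)

lemma countablyMeasurable_const (a : α) : CountablyMeasurable m fun _ : Ω => a :=
  ⟨(Set.countable_singleton a).mono (by rintro _ ⟨_, rfl⟩; rfl), fun _ => MeasurableSet.const _⟩

lemma CountablyMeasurable.comp {f : Ω → α} (hf : CountablyMeasurable m f) (φ : α → β) :
    CountablyMeasurable m fun ω => φ (f ω) :=
  hf.comp₂ (countablyMeasurable_const ()) fun a _ => φ a

lemma countable_lattice (n M : ℕ) : (lattice n M).Countable := by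
  refine (Set.countable_range fun f : Fin n → ℕ =>
    (WithLp.toLp 2 fun i => (f i : ℝ) / M : Vec n)).mono ?_
  intro x hx
  choose f hf using hx
  exact ⟨f, by ext i; exact (hf i).2.symm⟩

lemma iter_countablyMeasurable {n : ℕ} {L : ℕ} {u : ℕ → Ω → Vec n} (l : ℕ)
    (hu : ∀ j < l, CountablyMeasurable m (u j)) :
    CountablyMeasurable m fun ω => iter L (fun j => u j ω) l := by
  induction l with
  | zero => exact countablyMeasurable_const _
  | succ l ih =>
    exact (ih fun j hj => hu j (by omega)).comp₂ (hu l (by omega))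
      fun x v => x + (1 / (L : ℝ)) • (vee x v - x)

end Countable

/-! ### Drawing an index independently of the history -/

section Index

variable {Ω : Type*} {m mΩ : MeasurableSpace Ω} {μ : Measure Ω}

lemma integral_uniform_index {k : ℕ} {I : Ω → Fin k} (hm : m ≤ mΩ) (hI : Measurable I)
    (hunif : ∀ j, μ (I ⁻¹' {j}) = (k : ENNReal)⁻¹)
    (hind : Indep (MeasurableSpace.comap I inferInstance) m μ) {h : Fin k → Ω → ℝ}
    (hh : ∀ j, Measurable[m] (h j)) (hint : ∀ j, Integrable (h j) μ) :
    ∫ ω, h (I ω) ω ∂μ = ∫ ω, (1 / (k : ℝ)) * ∑ j, h j ω ∂μ := by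
  have hset : ∀ j, MeasurableSet (I ⁻¹' {j}) := fun j => hI (measurableSet_singleton j)
  have e : ∀ ω, h (I ω) ω = ∑ j, (I ⁻¹' {j}).indicator (h j) ω := by
    intro ω
    rw [Finset.sum_eq_single (I ω)]
    · simp
    · intro j _ hj
      exact Set.indicator_of_notMem (fun hmem => hj (by simpa using hmem.symm)) _
    · simp
  simp_rw [e]
  rw [integral_finsetSum _ fun j _ => (hint j).indicator (hset j), integral_const_mul,
    integral_finsetSum _ fun j _ => hint j, Finset.mul_sum]
  refine Finset.sum_congr rfl fun j _ => ?_
  rw [integral_indicator (hset j)]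
  have hle : MeasurableSpace.comap (h j) inferInstance ≤ m := (hh j).comap_le
  have := Indep.setIntegral_eq_mul (f := id) (X := h j) hI.comap_le
    (indep_of_indep_of_le_right hind hle) ((hh j).mono hm le_rfl).aemeasurable
    (A := I ⁻¹' {j}) ⟨{j}, measurableSet_singleton j, rfl⟩ (by fun_prop)
  simp only [id] at this
  rw [this, Measure.real, hunif j]
  simp

end Index

/-! ### The noise of the averaged estimates -/

section Noise

variable {n : ℕ} {Ω : Type*}

lemma measurable_avgGrad {m : MeasurableSpace Ω} {f : ℕ → Ω → Vec n} (l : ℕ)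
    (hf : ∀ j < l, Measurable[m] (f j)) :
    Measurable[m] fun ω => avgGrad (fun j => f j ω) l := by
  induction l with
  | zero => exact measurable_const
  | succ l ih =>
    exact ((ih fun j hj => hf j (by omega)).const_smul (1 - rho (l + 1))).add
      ((hf l (by omega)).const_smul (rho (l + 1)))

variable {mΩ : MeasurableSpace Ω} {μ : Measure Ω}

lemma memLp_avgGrad {f : ℕ → Ω → Vec n} (l : ℕ) (hf : ∀ j < l, MemLp (f j) 2 μ) :
    MemLp (fun ω => avgGrad (fun j => f j ω) l) 2 μ := by
  induction l with
  | zero => exact MemLp.zero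
  | succ l ih =>
    exact ((ih fun j hj => hf j (by omega)).const_smul (1 - rho (l + 1))).add
      ((hf l (by omega)).const_smul (rho (l + 1)))

lemma memLp_two_integrable_norm_sq {E : Type*} [NormedAddCommGroup E] {f : Ω → E}
    (hf : MemLp f 2 μ) : Integrable (fun ω => ‖f ω‖ ^ 2) μ :=
  (memLp_two_iff_integrable_sq_norm hf.1).1 hf

lemma memLp_two_integrable_inner {E : Type*} [NormedAddCommGroup E] [InnerProductSpace ℝ E]
    {f g : Ω → E} (hf : MemLp f 2 μ) (hg : MemLp g 2 μ) :
    Integrable (fun ω => inner ℝ (f ω) (g ω)) μ := by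
  refine ((memLp_two_integrable_norm_sq hf).add (memLp_two_integrable_norm_sq hg)).mono'
    (hf.1.inner hg.1) (Filter.Eventually.of_forall fun ω => ?_)
  refine (norm_inner_le_norm _ _).trans ?_
  simp only [Pi.add_apply]
  nlinarith [sq_nonneg (‖f ω‖ - ‖g ω‖), sq_nonneg (‖f ω‖ + ‖g ω‖)]

lemma integral_inner_eq_zero [IsProbabilityMeasure μ] {H : MeasurableSpace Ω} (hH : H ≤ mΩ)
    {N ξ : Ω → Vec n}
    (hN : Measurable[H] N) (hN2 : MemLp N 2 μ) (hξ2 : MemLp ξ 2 μ) (hξ : μ[ξ | H] =ᵐ[μ] 0) :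
    ∫ ω, inner ℝ (N ω) (ξ ω) ∂μ = 0 := by
  have hint : Integrable (fun ω => inner ℝ (N ω) (ξ ω)) μ := memLp_two_integrable_inner hN2 hξ2
  have h := condExp_bilin_of_stronglyMeasurable_left (m := H) (innerSL ℝ) hN.stronglyMeasurable
    (g := ξ) hint (hξ2.integrable (by norm_num))
  rw [← integral_condExp hH, integral_eq_zero_of_ae]
  filter_upwards [h, hξ] with ω h1 h2
  refine h1.trans ?_
  rw [h2]
  simp

/-- Averaging reduces the variance of unbiased gradient estimates to the order of the weights. -/
lemma integral_norm_avgGrad_noise_sq_le [IsProbabilityMeasure μ] {H : ℕ → MeasurableSpace Ω}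
    {L : ℕ} {σ : ℝ} {ξ : ℕ → Ω → Vec n} (hH : ∀ l < L, H l ≤ mΩ)
    (hmeas : ∀ l < L, ∀ j < l, Measurable[H l] (ξ j)) (hLp : ∀ l < L, MemLp (ξ l) 2 μ)
    (hmean : ∀ l < L, μ[ξ l | H l] =ᵐ[μ] 0) (hvar : ∀ l < L, ∫ ω, ‖ξ l ω‖ ^ 2 ∂μ ≤ σ ^ 2)
    (l : ℕ) (hl : l ≤ L) :
    ∫ ω, ‖avgGrad (fun j => ξ j ω) l‖ ^ 2 ∂μ ≤ 2 * σ ^ 2 * rho l := by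
  induction l with
  | zero => simpa [avgGrad] using mul_nonneg (by positivity) (rho_pos 0).le
  | succ l ih =>
    have h1 := ih (by omega)
    have hl' : l < L := hl
    have hN2 : MemLp (fun ω => avgGrad (fun j => ξ j ω) l) 2 μ :=
      memLp_avgGrad l fun j hj => hLp j (by omega)
    have h0 := integral_inner_eq_zero (hH l hl') (measurable_avgGrad l (hmeas l hl')) hN2
      (hLp l hl') (hmean l hl')
    have e : ∀ ω, ‖avgGrad (fun j => ξ j ω) (l + 1)‖ ^ 2
        = (1 - rho (l + 1)) ^ 2 * ‖avgGrad (fun j => ξ j ω) l‖ ^ 2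
          + 2 * (1 - rho (l + 1)) * rho (l + 1) * inner ℝ (avgGrad (fun j => ξ j ω) l) (ξ l ω)
          + rho (l + 1) ^ 2 * ‖ξ l ω‖ ^ 2 := by
      intro ω
      rw [avgGrad_succ, norm_add_sq_real, inner_smul_left, inner_smul_right, norm_smul, norm_smul,
        mul_pow, mul_pow, Real.norm_eq_abs, Real.norm_eq_abs, sq_abs, sq_abs]
      simp only [conj_trivial]
      ring
    simp_rw [e]
    have i1 := (memLp_two_integrable_norm_sq hN2).const_mul ((1 - rho (l + 1)) ^ 2)
    have i2 := (memLp_two_integrable_inner hN2 (hLp l hl')).const_mul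
      (2 * (1 - rho (l + 1)) * rho (l + 1))
    have i3 := (memLp_two_integrable_norm_sq (hLp l hl')).const_mul (rho (l + 1) ^ 2)
    rw [integral_add (i1.fun_add i2) i3, integral_add i1 i2, integral_const_mul, integral_const_mul,
      integral_const_mul, h0, mul_zero, add_zero]
    have h2 := hvar l hl'
    have h3 := rho_pos (l + 1)
    have h4 := rho_le_one (Nat.le_add_left 1 l)
    have h5 := rho_pos l
    have h6 := rho_recursion l
    have h7 : (1 - rho (l + 1)) ^ 2 ≤ 1 - rho (l + 1) := by nlinarith
    have h8 : 0 ≤ 2 * σ ^ 2 * rho l := by positivity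
    calc _ ≤ (1 - rho (l + 1)) ^ 2 * (2 * σ ^ 2 * rho l) + rho (l + 1) ^ 2 * σ ^ 2 := by gcongr
      _ ≤ (1 - rho (l + 1)) * (2 * σ ^ 2 * rho l) + rho (l + 1) ^ 2 * σ ^ 2 := by gcongr
      _ = σ ^ 2 * ((1 - rho (l + 1)) * (2 * rho l) + rho (l + 1) ^ 2) := by ring
      _ ≤ σ ^ 2 * (2 * rho (l + 1)) := by gcongr
      _ = _ := by ring

end Noise

/-! ### One iteration along a fixed path -/

section Path

variable {n M k : ℕ} {K : Set (Vec n)} {G β : ℝ} {F : Vec n → ℝ}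

lemma IsReward.norm_grad_le (hF : IsReward K G β F) (hG : 0 ≤ G) {x : Vec n} (hx : x ∈ cube n) :
    ‖grad F x‖ ≤ 2 * G :=
  OnlineDR.norm_grad_le hG hF.differentiable hF.lipschitz hx

/-- The progress of one iteration, for arbitrary feedback `d`. The exact gradient `a = ∇F(x)` and
the feedback enter through their lifted rewards `r_a` and `r_d`: the first one carries the rounding
steps, whose cost is therefore independent of the noise, and the second one the regret of the
oracle. The difference of the two is paid for by `2 D ‖d - a‖`. -/
lemma IsReward.progress (hF : IsReward K G β F) (hG : 0 ≤ G) (hM : 1 ≤ M) (hne : K.Nonempty)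
    (hK : K ⊆ cube n) (hd : DownClosed K) {L : ℕ} (hL : 1 ≤ L) {x u xs d : Vec n} (hx : x ∈ K)
    (hu : u ∈ K ∩ lattice n M) (hxs : xs ∈ K) {q : ℝ} (hq0 : 0 ≤ q) (hq1 : q ≤ 1)
    (hq : ∀ i, x i ≤ 1 - q) {x' : Vec n} (hx' : x' - x = (1 / (L : ℝ)) • (vee x u - x))
    (hx'K : x' ∈ K) {y p : LVec n M} {ε : ℝ} (hy : y ∈ polytope M K) (hp : ‖y - p‖ ≤ ε) :
    1 / (L : ℝ) * (q * F xs - F x - (6 * G * √n / M + 2 * G * ε)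
      - inner ℝ (liftedReward M d x) (lift M (roundDown M xs) - y)
      - 2 * Metric.diam K * ‖d - grad F x‖ - Metric.diam K * ‖grad F x' - grad F x‖
      + (inner ℝ (liftedReward M (grad F x) x) (lift M u)
        - inner ℝ (liftedReward M (grad F x) x) p)) ≤ F x' - F x := by
  set a := grad F x with ha
  set r := liftedReward M a x with hr
  have hxc := hK hx
  have hL0 : 0 ≤ 1 / (L : ℝ) := by positivity
  have hsq : 0 ≤ √(n : ℝ) * (1 / M) := by positivity
  have hanorm : ‖a‖ ≤ 2 * G := hF.norm_grad_le hG hxc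
  have hv := vee_sub_mem hK hd hxc hu.1
  have hvD := norm_le_diam hne hK hd hv
  have hmono : ∀ j, x j ≤ x' j := by
    intro j
    have : 0 ≤ (x' - x) j := by
      rw [hx']
      simp only [PiLp.smul_apply, smul_eq_mul]
      exact mul_nonneg hL0 (hK hv j).1
    simpa using this
  -- Concavity between the iterates, with the gradient at the new iterate.
  have s1 : 1 / (L : ℝ) * (inner ℝ a (vee x u - x) - Metric.diam K * ‖grad F x' - a‖)
      ≤ F x' - F x := by
    refine le_trans ?_
      (inner_grad_le_sub_le_inner_grad hF.differentiable hF.dr hxc (hK hx'K) hmono).1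
    rw [hx', inner_smul_right]
    refine mul_le_mul_of_nonneg_left ?_ hL0
    have h1 : inner ℝ (grad F x') (vee x u - x)
        = inner ℝ a (vee x u - x) + inner ℝ (grad F x' - a) (vee x u - x) := by
      rw [inner_sub_left]; ring
    have h2 := abs_real_inner_le_norm (grad F x' - a) (vee x u - x)
    have h3 := neg_abs_le (inner ℝ (grad F x' - a) (vee x u - x))
    have h4 := mul_le_mul_of_nonneg_left hvD (norm_nonneg (grad F x' - a))
    rw [h1]; linarith
  refine le_trans (mul_le_mul_of_nonneg_left ?_ hL0) s1
  have s2 : inner ℝ r (lift M u) - 2 * G * (√n * (1 / M)) ≤ inner ℝ a (vee x u - x) := by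
    rw [hr, inner_liftedReward_lift hM a x hu.2]
    have h1 := abs_inner_gain_sub_le hM a u u hxc
    rw [sub_self, norm_zero, add_zero] at h1
    have h2 := le_abs_self (inner ℝ a (gain M x u) - inner ℝ a (vee x u - x))
    have h3 := mul_le_mul_of_nonneg_right hanorm hsq
    linarith
  have s3 : inner ℝ r y - 2 * G * ε ≤ inner ℝ r p := by
    have h1 := abs_real_inner_le_norm r (y - p)
    have h2 := le_abs_self (inner ℝ r (y - p))
    have h3 : ‖r‖ * ‖y - p‖ ≤ 2 * G * ε :=
      mul_le_mul ((norm_liftedReward_le hM a x).trans hanorm) hp (norm_nonneg _) (by positivity)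
    rw [inner_sub_right] at h1 h2
    linarith
  have hz := roundDown_mem hM hK hd hxs
  have hzp : lift M (roundDown M xs) ∈ polytope M K := subset_convexHull ℝ _ ⟨_, hz, rfl⟩
  have s4 : inner ℝ r (lift M (roundDown M xs))
      - inner ℝ (liftedReward M d x) (lift M (roundDown M xs) - y)
      - 2 * Metric.diam K * ‖d - a‖ ≤ inner ℝ r y := by
    have h1 := abs_inner_liftedReward_le hM hne hK hd (d - a) x hy
    have h2 := abs_inner_liftedReward_le hM hne hK hd (d - a) x hzp
    rw [liftedReward_sub, inner_sub_left] at h1 h2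
    rw [inner_sub_right]
    have h3 := (abs_le.1 h1).2
    have h4 := (abs_le.1 h2).1
    linarith
  have s5 : inner ℝ a (vee x xs - x) - 4 * G * (√n * (1 / M))
      ≤ inner ℝ r (lift M (roundDown M xs)) := by
    rw [hr, inner_liftedReward_lift hM a x hz.2]
    have h1 := abs_inner_gain_sub_le hM a (roundDown M xs) xs hxc
    have h2 := neg_abs_le (inner ℝ a (gain M x (roundDown M xs)) - inner ℝ a (vee x xs - x))
    have h3 := norm_roundDown_sub_le hM (hK hxs)
    have h4 : ‖a‖ * (√n * (1 / M) + ‖roundDown M xs - xs‖) ≤ 2 * G * (2 * (√n * (1 / M))) :=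
      mul_le_mul hanorm (by linarith) (by positivity) (by positivity)
    linarith
  have s6 : q * F xs - F x ≤ inner ℝ a (vee x xs - x) := by
    have h1 := mul_le_vee hF.differentiable hF.dr hF.nonneg hxc (hK hxs) hq0 hq1 hq
    have h2 := (inner_grad_le_sub_le_inner_grad hF.differentiable hF.dr hxc
      (vee_mem_cube hxc (hK hxs)) fun _ => le_max_left _ _).2
    linarith
  have e : 6 * G * √n / M = 2 * G * (√n * (1 / M)) + 4 * G * (√n * (1 / M)) := by ring
  rw [e]
  linarith

lemma isBounded_polytope : Bornology.IsBounded (polytope M K) := by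
  rw [polytope, isBounded_convexHull]
  refine Metric.isBounded_iff.2 ⟨√((n : ℝ) * M), ?_⟩
  rintro _ ⟨x, _, rfl⟩ _ ⟨y, _, rfl⟩
  rw [dist_eq_norm]
  exact Real.le_sqrt_of_sq_le (norm_lift_sub_sq_le x y)

end Path

/-! ### The run of the algorithm -/

/-- The standing assumptions on a run of the algorithm, for a lattice with an arbitrary number
`M ≥ 1` of steps per coordinate. -/
structure Setting {n M k : ℕ} {Ω : Type*} [MeasurableSpace Ω] (R : Run n M k Ω) (μ : Measure Ω)
    (K : Set (Vec n)) (F : ℕ → Vec n → ℝ) (T L : ℕ) (G β σ c : ℝ) : Prop where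
  one_le_M : 1 ≤ M
  one_le_T : 1 ≤ T
  one_le_L : 1 ≤ L
  nonempty : K.Nonempty
  subset_cube : K ⊆ cube n
  convex : Convex ℝ K
  downClosed : DownClosed K
  G_nonneg : 0 ≤ G
  σ_nonneg : 0 ≤ σ
  c_nonneg : 0 ≤ c
  reward : ∀ t < T, IsReward K G β (F t)
  oracles : R.VeeOracles μ K T L G c
  gradients : R.StochasticGradients μ F T L σ

namespace Run

variable {n M k : ℕ} {Ω : Type*} (R : Run n M k Ω)

lemma measurable_pts_histIdx {L s t l j : ℕ} (hs : s ≤ t) (hj : j < L) :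
    Measurable[R.histIdx L t l] (R.pts s j) := by
  refine Measurable.of_comap_le (le_sup_of_le_left (le_sup_of_le_left ?_))
  exact le_iSup₂_of_le s hs (le_iSup₂_of_le j hj le_rfl)

lemma measurable_idx_histIdx {L t l j : ℕ} (hj : j < l) :
    Measurable[R.histIdx L t l] (R.idx t j) := by
  refine Measurable.of_comap_le (le_sup_of_le_right ?_)
  exact le_iSup₂_of_le j hj le_rfl

lemma measurable_pts_histGrad {L t l j : ℕ} (hj : j < L) :
    Measurable[R.histGrad L t l] (R.pts t j) := by
  refine Measurable.of_comap_le (le_sup_of_le_left (le_sup_of_le_left ?_))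
  exact le_iSup₂_of_le t le_rfl (le_iSup₂_of_le j hj le_sup_left)

lemma measurable_idx_histGrad {L t l j : ℕ} (hj : j < L) :
    Measurable[R.histGrad L t l] (R.idx t j) := by
  refine Measurable.of_comap_le (le_sup_of_le_left (le_sup_of_le_left ?_))
  exact le_iSup₂_of_le t le_rfl (le_iSup₂_of_le j hj le_sup_right)

lemma measurable_g_histGrad {L t l j : ℕ} (hj : j < l) :
    Measurable[R.histGrad L t l] (R.g t j) := by
  refine Measurable.of_comap_le (le_sup_of_le_right ?_)
  exact le_iSup₂_of_le j hj le_rfl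

/-- The exact gradient `∇F^t(x^t_l)`. -/
noncomputable def trueGrad (F : ℕ → Vec n → ℝ) (L t l : ℕ) (ω : Ω) : Vec n :=
  grad (F t) (R.x L t l ω)

/-- The average of the gradient noise, with the weights of the gradient estimates. -/
noncomputable def noise (F : ℕ → Vec n → ℝ) (L t l : ℕ) (ω : Ω) : Vec n :=
  avgGrad (fun j => R.g t j ω - R.trueGrad F L t j ω) l

/-- The lag `m_{l+1} - ∇F^t(x^t_l)` of the average `m_{l+1}` of the exact gradients. -/
noncomputable def lag (F : ℕ → Vec n → ℝ) (L t l : ℕ) (ω : Ω) : Vec n :=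
  avgGrad (fun j => R.trueGrad F L t j ω) (l + 1) - R.trueGrad F L t l ω

/-- The loss of an iteration that is due to the inexact feedback and to the change of the gradient
along the step. -/
noncomputable def gradLoss (K : Set (Vec n)) (F : ℕ → Vec n → ℝ) (L t l : ℕ) (ω : Ω) : ℝ :=
  2 * Metric.diam K * ‖R.noise F L t (l + 1) ω‖ + (2 * Metric.diam K * ‖R.lag F L t l ω‖
    + Metric.diam K * ‖R.trueGrad F L t (l + 1) ω - R.trueGrad F L t l ω‖)

lemma d_eq (F : ℕ → Vec n → ℝ) (L t l : ℕ) (ω : Ω) :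
    R.d t l ω = avgGrad (fun j => R.trueGrad F L t j ω) l + R.noise F L t l ω := by
  rw [noise, ← avgGrad_add, d]
  congr 1
  funext j
  abel

lemma pts_countablyMeasurable {t l : ℕ} {m : MeasurableSpace Ω}
    (hp : ∀ ω i, R.pts t l ω i ∈ lattice n M) (hm : Measurable[m] (R.pts t l)) :
    CountablyMeasurable m (R.pts t l) := by
  refine countablyMeasurable_of_measurable ?_ hm
  refine (Set.countable_univ_pi fun _ : Fin k => countable_lattice n M).mono ?_
  rintro _ ⟨ω, rfl⟩ i _
  exact hp ω i

lemma x_countablyMeasurable {L t l : ℕ} {m : MeasurableSpace Ω}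
    (hp : ∀ j < l, ∀ ω i, R.pts t j ω i ∈ lattice n M) (hm : ∀ j < l, Measurable[m] (R.pts t j))
    (hi : ∀ j < l, Measurable[m] (R.idx t j)) : CountablyMeasurable m (R.x L t l) :=
  iter_countablyMeasurable l fun j hj =>
    (R.pts_countablyMeasurable (hp j hj) (hm j hj)).comp₂
      (countablyMeasurable_of_measurable (Set.to_countable _) (hi j hj)) fun p i => p i

end Run

namespace Setting

variable {n M k : ℕ} {Ω : Type*} [mΩ : MeasurableSpace Ω] {R : Run n M k Ω} {μ : Measure Ω}
  {K : Set (Vec n)} {F : ℕ → Vec n → ℝ} {T L : ℕ} {G β σ c : ℝ}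

lemma u_mem (h : Setting R μ K F T L G β σ c) {t l : ℕ} (ht : t < T) (hl : l < L) (ω : Ω) :
    R.u t l ω ∈ K ∩ lattice n M :=
  h.oracles.pts_mem t ht l hl ω _

lemma x_mem (h : Setting R μ K F T L G β σ c) {t l : ℕ} (ht : t < T) (hl : l ≤ L) (ω : Ω) :
    R.x L t l ω ∈ K :=
  iter_mem h.nonempty h.subset_cube h.convex h.downClosed
    (fun _ hj => (h.u_mem ht hj ω).1) hl

lemma x_mem_cube (h : Setting R μ K F T L G β σ c) {t l : ℕ} (ht : t < T) (hl : l ≤ L) (ω : Ω) :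
    R.x L t l ω ∈ cube n :=
  h.subset_cube (h.x_mem ht hl ω)

lemma x_countablyMeasurable_self (h : Setting R μ K F T L G β σ c) {t l : ℕ} (ht : t < T)
    (hl : l ≤ L) : CountablyMeasurable mΩ (R.x L t l) :=
  R.x_countablyMeasurable (fun j hj ω i => (h.oracles.pts_mem t ht j (by omega) ω i).2)
    (fun j hj => h.oracles.measurable_pts t ht j (by omega))
    fun j hj => h.oracles.measurable_idx t ht j (by omega)

lemma histIdx_le (h : Setting R μ K F T L G β σ c) {t l : ℕ} (ht : t < T) (hl : l < L) :
    R.histIdx L t l ≤ mΩ := by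
  refine sup_le (sup_le ?_ ?_) ?_
  · exact iSup₂_le fun s hs => iSup₂_le fun j hj =>
      (h.oracles.measurable_pts s (by omega) j hj).comap_le
  · exact iSup₂_le fun s hs => iSup₂_le fun j hj => sup_le
      (h.oracles.measurable_idx s (by omega) j hj).comap_le
      (h.gradients.measurable_g s (by omega) j hj).comap_le
  · exact iSup₂_le fun j hj => (h.oracles.measurable_idx t ht j (by omega)).comap_le

lemma histGrad_le (h : Setting R μ K F T L G β σ c) {t l : ℕ} (ht : t < T) (hl : l < L) :
    R.histGrad L t l ≤ mΩ := by
  refine sup_le (sup_le ?_ ?_) ?_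
  · exact iSup₂_le fun s hs => iSup₂_le fun j hj => sup_le
      (h.oracles.measurable_pts s (by omega) j hj).comap_le
      (h.oracles.measurable_idx s (by omega) j hj).comap_le
  · exact iSup₂_le fun s hs => iSup₂_le fun j hj =>
      (h.gradients.measurable_g s (by omega) j hj).comap_le
  · exact iSup₂_le fun j hj => (h.gradients.measurable_g t ht j (by omega)).comap_le

lemma norm_trueGrad_le (h : Setting R μ K F T L G β σ c) {t l : ℕ} (ht : t < T) (hl : l ≤ L)
    (ω : Ω) : ‖R.trueGrad F L t l ω‖ ≤ 2 * G :=
  (h.reward t ht).norm_grad_le h.G_nonneg (h.x_mem_cube ht hl ω)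

lemma memLp_d (h : Setting R μ K F T L G β σ c) {t l : ℕ} (ht : t < T) (hl : l ≤ L) :
    MemLp (R.d t l) 2 μ :=
  memLp_avgGrad l fun j hj => h.gradients.memLp t ht j (by omega)

lemma y_mem (h : Setting R μ K F T L G β σ c) {t l : ℕ} (ht : t < T) (hl : l < L) (ω : Ω) :
    R.y t l ω ∈ polytope M K := by
  rcases h.oracles.update l hl with hu | hu
  · rcases t with _ | t
    · exact subset_convexHull ℝ _ (hu ω).1
    · exact ((hu ω).2 t ht).1
  · exact hu.1 t ht ω

lemma memLp_reward (h : Setting R μ K F T L G β σ c) {t l : ℕ} (ht : t < T) (hl : l < L) :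
    MemLp (R.reward L t l) 2 μ := by
  refine (h.memLp_d ht (by omega : l + 1 ≤ L)).of_le ?_
    (Filter.Eventually.of_forall fun ω => norm_liftedReward_le h.one_le_M _ _)
  have hd : Measurable (R.d t (l + 1)) := measurable_avgGrad (l + 1) fun j hj =>
    h.gradients.measurable_g t ht j (by omega)
  refine Measurable.aestronglyMeasurable ((WithLp.measurable_toLp 2 _).comp
    (measurable_pi_lambda _ fun p => ?_))
  refine Measurable.mul ?_ ((h.x_countablyMeasurable_self ht hl.le).comp
    fun x => 1 - lift M (roundDown M x) p).measurable
  exact Measurable.div_const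
    ((measurable_pi_apply p.1).comp ((WithLp.measurable_ofLp 2 _).comp hd)) _

variable [IsProbabilityMeasure μ]

lemma memLp_trueGrad (h : Setting R μ K F T L G β σ c) {t l : ℕ} (ht : t < T) (hl : l ≤ L) :
    MemLp (R.trueGrad F L t l) 2 μ :=
  MemLp.of_bound
    ((h.x_countablyMeasurable_self ht hl).comp (grad (F t))).measurable.aestronglyMeasurable
    (2 * G) (Filter.Eventually.of_forall fun ω => h.norm_trueGrad_le ht hl ω)

lemma memLp_noise (h : Setting R μ K F T L G β σ c) {t l : ℕ} (ht : t < T) (hl : l ≤ L) :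
    MemLp (R.noise F L t l) 2 μ :=
  memLp_avgGrad l fun j hj => (h.gradients.memLp t ht j (by omega)).sub
    (h.memLp_trueGrad ht (by omega))

lemma memLp_lag (h : Setting R μ K F T L G β σ c) {t l : ℕ} (ht : t < T) (hl : l < L) :
    MemLp (R.lag F L t l) 2 μ :=
  (memLp_avgGrad (f := fun j => R.trueGrad F L t j) (l + 1)
    fun j hj => h.memLp_trueGrad ht (by omega)).sub (h.memLp_trueGrad ht (by omega))

lemma integral_noise_sq_le (h : Setting R μ K F T L G β σ c) {t l : ℕ} (ht : t < T)
    (hl : l ≤ L) : ∫ ω, ‖R.noise F L t l ω‖ ^ 2 ∂μ ≤ 2 * σ ^ 2 * rho l := by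
  have hx : ∀ i < L, ∀ j ≤ i, Measurable[R.histGrad L t i] (R.trueGrad F L t j) := fun i hi j hj =>
    ((R.x_countablyMeasurable (fun j' hj' ω i' => (h.oracles.pts_mem t ht j' (by omega) ω i').2)
      (fun j' hj' => R.measurable_pts_histGrad (by omega))
      fun j' hj' => R.measurable_idx_histGrad (by omega)).comp (grad (F t))).measurable
  refine integral_norm_avgGrad_noise_sq_le (H := R.histGrad L t) (L := L)
    (ξ := fun j ω => R.g t j ω - R.trueGrad F L t j ω) (fun i hi => h.histGrad_le ht hi)
    (fun i hi j hj => (R.measurable_g_histGrad hj).sub (hx i hi j hj.le))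
    (fun i hi => (h.gradients.memLp t ht i hi).sub (h.memLp_trueGrad ht hi.le))
    (fun i hi => ?_) (fun i hi => h.gradients.variance t ht i hi) l hl
  have h1 := condExp_sub ((h.gradients.memLp t ht i hi).integrable (by norm_num))
    ((h.memLp_trueGrad ht hi.le).integrable (by norm_num)) (R.histGrad L t i)
  have h2 := condExp_of_stronglyMeasurable (h.histGrad_le ht hi)
    (hx i hi i le_rfl).stronglyMeasurable ((h.memLp_trueGrad ht hi.le).integrable (by norm_num) :
      Integrable (R.trueGrad F L t i) μ)
  refine h1.trans ?_
  rw [h2]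
  filter_upwards [h.gradients.unbiased t ht i hi] with ω hω
  simp [Pi.sub_apply, hω, Run.trueGrad]

lemma integral_norm_noise_le (h : Setting R μ K F T L G β σ c) {t l : ℕ} (ht : t < T)
    (hl : l ≤ L) : ∫ ω, ‖R.noise F L t l ω‖ ∂μ ≤ σ * √(2 * rho l) := by
  have h1 := h.memLp_noise ht hl
  have h2 : Integrable (fun ω => ‖R.noise F L t l ω‖) μ := (h1.integrable (by norm_num)).norm
  have h3 := memLp_two_integrable_norm_sq h1
  set m := ∫ ω, ‖R.noise F L t l ω‖ ∂μ with hm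
  have h4 : 0 ≤ ∫ ω, (‖R.noise F L t l ω‖ - m) ^ 2 ∂μ := integral_nonneg fun ω => sq_nonneg _
  have h5 : ∫ ω, (‖R.noise F L t l ω‖ - m) ^ 2 ∂μ
      = ∫ ω, ‖R.noise F L t l ω‖ ^ 2 ∂μ - 2 * m * m + m ^ 2 := by
    have e : ∀ ω, (‖R.noise F L t l ω‖ - m) ^ 2
        = ‖R.noise F L t l ω‖ ^ 2 - 2 * m * ‖R.noise F L t l ω‖ + m ^ 2 := fun ω => by ring
    simp_rw [e]
    have h6 : Integrable (fun ω => ‖R.noise F L t l ω‖ ^ 2 - 2 * m * ‖R.noise F L t l ω‖) μ :=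
      h3.sub (h2.const_mul (2 * m))
    rw [integral_add h6 (integrable_const _),
      integral_sub h3 (h2.const_mul (2 * m)), integral_const_mul, ← hm]
    simp
  have h6 := h.integral_noise_sq_le ht hl
  refine abs_le_of_sq_le_sq' ?_ (mul_nonneg h.σ_nonneg (Real.sqrt_nonneg _)) |>.2
  rw [mul_pow, Real.sq_sqrt (by have := rho_pos l; positivity)]
  linarith

lemma integral_norm_d_sq_le (h : Setting R μ K F T L G β σ c) {t l : ℕ} (ht : t < T)
    (hl : l ≤ L) : ∫ ω, ‖R.d t l ω‖ ^ 2 ∂μ ≤ 8 * G ^ 2 + 4 * σ ^ 2 * rho l := by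
  have h1 := memLp_two_integrable_norm_sq (h.memLp_noise (μ := μ) ht hl)
  have h2 : ∫ ω, ‖R.d t l ω‖ ^ 2 ∂μ ≤ ∫ ω, (8 * G ^ 2 + 2 * ‖R.noise F L t l ω‖ ^ 2) ∂μ := by
    refine integral_mono (memLp_two_integrable_norm_sq (h.memLp_d ht hl))
      ((integrable_const _).add (h1.const_mul 2)) fun ω => ?_
    have h3 : ‖avgGrad (fun j => R.trueGrad F L t j ω) l‖ ≤ 2 * G :=
      norm_avgGrad_le (by linarith [h.G_nonneg]) l fun j hj =>
        h.norm_trueGrad_le ht (by omega) ω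
    have h4 : ‖R.d t l ω‖ ≤ 2 * G + ‖R.noise F L t l ω‖ := by
      rw [R.d_eq F L]
      exact (norm_add_le _ _).trans (add_le_add_left h3 _)
    have h5 := pow_le_pow_left₀ (norm_nonneg _) h4 2
    simp only
    nlinarith [sq_nonneg (2 * G - ‖R.noise F L t l ω‖)]
  rw [integral_add (integrable_const _) (h1.const_mul 2), integral_const_mul 2] at h2
  have h6 := h.integral_noise_sq_le ht hl
  simp only [integral_const, probReal_univ, one_smul] at h2
  linarith

lemma memLp_y (h : Setting R μ K F T L G β σ c) {t l : ℕ} (ht : t < T) (hl : l < L) :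
    MemLp (R.y t l) 2 μ := by
  obtain ⟨B, hB⟩ := (isBounded_polytope (M := M) (K := K)).exists_norm_le
  exact MemLp.of_bound (h.oracles.measurable_y t ht l hl).aestronglyMeasurable B
    (Filter.Eventually.of_forall fun ω => hB _ (h.y_mem ht hl ω))

lemma integrable_inner_reward (h : Setting R μ K F T L G β σ c) {t l : ℕ} (ht : t < T)
    (hl : l < L) (z : LVec n M) :
    Integrable (fun ω => inner ℝ (R.reward L t l ω) (z - R.y t l ω)) μ :=
  memLp_two_integrable_inner (h.memLp_reward ht hl) ((memLp_const z).sub (h.memLp_y ht hl))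

/-- The regret of oracle `l` against a lifted lattice point. The noise enters the bound for
gradient ascent through its variance only. -/
lemma regret_le (h : Setting R μ K F T L G β σ c) (hn : 1 ≤ n) (hG : 0 < G) {l : ℕ} (hl : l < L)
    {z : LVec n M} (hz : z ∈ liftedSet M K) :
    ∑ t ∈ Finset.range T, ∫ ω, inner ℝ (R.reward L t l ω) (z - R.y t l ω) ∂μ
      ≤ c * n * M * G * √(T : ℝ) + (√((n : ℝ) * M) * G * √(T : ℝ) / 2
        + √((n : ℝ) * M) / (G * √(T : ℝ)) / 2
          * (T * ((8 * G ^ 2 + 4 * σ ^ 2 * rho (l + 1)) / M))) := by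
  have hc := h.c_nonneg
  have hρ := rho_pos (l + 1)
  have hM : (0 : ℝ) < M := by exact_mod_cast h.one_le_M
  have hT : (0 : ℝ) < T := by exact_mod_cast h.one_le_T
  have hn' : (0 : ℝ) < n := by exact_mod_cast hn
  have hzp : z ∈ polytope M K := subset_convexHull ℝ _ hz
  rcases h.oracles.update l hl with hu | hu
  · refine le_add_of_nonneg_of_le (by positivity) ?_
    set η := √((n : ℝ) * M) / (G * √(T : ℝ)) with hη
    have hη0 : 0 < η := by positivity
    have hint : ∀ t ∈ Finset.range T, Integrable (fun ω => ‖R.reward L t l ω‖ ^ 2) μ :=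
      fun t ht => memLp_two_integrable_norm_sq (h.memLp_reward (Finset.mem_range.1 ht) hl)
    have h1 : ∀ ω, ∑ t ∈ Finset.range T, inner ℝ (R.reward L t l ω) (z - R.y t l ω)
        ≤ n * M / (2 * η) + η / 2 * ∑ t ∈ Finset.range T, ‖R.reward L t l ω‖ ^ 2 := by
      intro ω
      refine (sum_inner_sub_le_of_isProj (convex_convexHull ℝ (liftedSet M K)) hη0
        (fun t => R.reward L t l ω) (fun t => R.y t l ω) hzp T (hu ω).2).trans ?_
      gcongr
      obtain ⟨p, _, rfl⟩ := hz
      obtain ⟨p', _, hp'⟩ := (hu ω).1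
      rw [← hp']
      exact norm_lift_sub_sq_le p p'
    rw [← integral_finsetSum _ fun t ht => h.integrable_inner_reward (Finset.mem_range.1 ht) hl z]
    refine (integral_mono (integrable_finsetSum _ fun t ht =>
      h.integrable_inner_reward (Finset.mem_range.1 ht) hl z)
      ((integrable_const _).fun_add ((integrable_finsetSum _ hint).const_mul _)) h1).trans ?_
    rw [integral_add (integrable_const _) ((integrable_finsetSum _ hint).const_mul _),
      integral_const_mul, integral_finsetSum _ hint]
    simp only [integral_const, probReal_univ, one_smul]
    have e : (n : ℝ) * M / (2 * η) = √((n : ℝ) * M) * G * √(T : ℝ) / 2 := by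
      have hs : √((n : ℝ) * M) * √((n : ℝ) * M) = n * M := Real.mul_self_sqrt (by positivity)
      rw [hη]
      nth_rewrite 1 [← hs]
      field_simp
    rw [e]
    gcongr
    refine (Finset.sum_le_sum (g := fun _ => (8 * G ^ 2 + 4 * σ ^ 2 * rho (l + 1)) / M)
      fun t ht => ?_).trans (le_of_eq (by simp))
    have ht' := Finset.mem_range.1 ht
    have h2 : ∫ ω, ‖R.reward L t l ω‖ ^ 2 ∂μ ≤ ∫ ω, ‖R.d t (l + 1) ω‖ ^ 2 / M ∂μ :=
      integral_mono (hint t ht)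
        ((memLp_two_integrable_norm_sq (h.memLp_d ht' (by omega : l + 1 ≤ L))).div_const _)
        fun ω => norm_liftedReward_sq_le h.one_le_M _ _
    refine h2.trans ?_
    rw [integral_div]
    gcongr
    exact h.integral_norm_d_sq_le ht' (by omega)
  · refine (hu.2 z hzp).trans (le_add_of_nonneg_right (by positivity))

end Setting

/-! ### Expected progress and the proof of the bounds -/

lemma integrable_fun_sub {Ω E : Type*} [NormedAddCommGroup E] [MeasurableSpace Ω] {μ : Measure Ω}
    {f g : Ω → E} (hf : Integrable f μ) (hg : Integrable g μ) :
    Integrable (fun ω => f ω - g ω) μ :=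
  hf.sub hg

namespace Setting

variable {n M k : ℕ} {Ω : Type*} [mΩ : MeasurableSpace Ω] {R : Run n M k Ω} {μ : Measure Ω}
  {K : Set (Vec n)} {F : ℕ → Vec n → ℝ} {T L : ℕ} {G β σ c : ℝ}

variable [IsProbabilityMeasure μ]

lemma integrable_reward_value (h : Setting R μ K F T L G β σ c) {t l : ℕ} (ht : t < T)
    (hl : l ≤ L) : Integrable (fun ω => F t (R.x L t l ω)) μ := by
  refine Integrable.of_bound
    ((h.x_countablyMeasurable_self ht hl).comp (F t)).measurable.aestronglyMeasurable
    (F t 0 + G * √n) (Filter.Eventually.of_forall fun ω => ?_)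
  have hx := h.x_mem_cube ht hl ω
  have h0 := h.subset_cube (zero_mem h.nonempty h.subset_cube h.downClosed)
  have h1 := (abs_le.1 ((h.reward t ht).lipschitz _ hx 0 h0)).2
  have h2 := mul_le_mul_of_nonneg_left (norm_sub_le_sqrt hx h0) h.G_nonneg
  rw [Real.norm_of_nonneg ((h.reward t ht).nonneg _ hx)]
  linarith

/-- Rounding is unbiased: the exact gradient at `x^t_l` is determined by the history before the
index of oracle `l` is drawn, so the index is independent of the lifted reward it meets. -/
lemma integral_rounding (h : Setting R μ K F T L G β σ c) {t l : ℕ} (ht : t < T) (hl : l < L) :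
    Integrable (fun ω => inner ℝ (liftedReward M (R.trueGrad F L t l ω) (R.x L t l ω))
      (lift M (R.u t l ω))) μ ∧
    Integrable (fun ω => inner ℝ (liftedReward M (R.trueGrad F L t l ω) (R.x L t l ω))
      ((1 / (k : ℝ)) • ∑ j, lift M (R.pts t l ω j))) μ ∧
    ∫ ω, inner ℝ (liftedReward M (R.trueGrad F L t l ω) (R.x L t l ω)) (lift M (R.u t l ω)) ∂μ
      = ∫ ω, inner ℝ (liftedReward M (R.trueGrad F L t l ω) (R.x L t l ω))
        ((1 / (k : ℝ)) • ∑ j, lift M (R.pts t l ω j)) ∂μ := by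
  let φ : Vec n → Vec n → ℝ := fun x p => inner ℝ (liftedReward M (grad (F t) x) x) (lift M p)
  have hlat : ∀ j ≤ l, ∀ ω i, R.pts t j ω i ∈ lattice n M := fun j hj ω i =>
    (h.oracles.pts_mem t ht j (by omega) ω i).2
  have hx : CountablyMeasurable (R.histIdx L t l) (R.x L t l) :=
    R.x_countablyMeasurable (fun j hj => hlat j hj.le)
      (fun j hj => R.measurable_pts_histIdx le_rfl (by omega))
      fun j hj => R.measurable_idx_histIdx hj
  have hp : CountablyMeasurable (R.histIdx L t l) (R.pts t l) :=
    R.pts_countablyMeasurable (hlat l le_rfl) (R.measurable_pts_histIdx le_rfl hl)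
  have hmeas : ∀ j, Measurable[R.histIdx L t l] fun ω => φ (R.x L t l ω) (R.pts t l ω j) :=
    fun j => (hx.comp₂ hp fun x p => φ x (p j)).measurable
  have hu : CountablyMeasurable mΩ (R.u t l) :=
    (R.pts_countablyMeasurable (hlat l le_rfl) (h.oracles.measurable_pts t ht l hl)).comp₂
      (countablyMeasurable_of_measurable (Set.to_countable _)
        (h.oracles.measurable_idx t ht l hl)) fun p i => p i
  have hb : ∀ ω, ∀ p ∈ K ∩ lattice n M,
      ‖φ (R.x L t l ω) p‖ ≤ 2 * G * Metric.diam K := by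
    intro ω p hp
    refine (abs_inner_liftedReward_le h.one_le_M h.nonempty h.subset_cube h.downClosed _ _
      (subset_convexHull ℝ _ ⟨p, hp, rfl⟩)).trans ?_
    exact mul_le_mul_of_nonneg_right (h.norm_trueGrad_le ht hl.le ω) Metric.diam_nonneg
  have hint : ∀ j, Integrable (fun ω => φ (R.x L t l ω) (R.pts t l ω j)) μ := fun j =>
    Integrable.of_bound ((hmeas j).mono (h.histIdx_le ht hl) le_rfl).aestronglyMeasurable _
      (Filter.Eventually.of_forall fun ω => hb ω _ (h.oracles.pts_mem t ht l hl ω j))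
  have hmain := integral_uniform_index (h.histIdx_le ht hl) (h.oracles.measurable_idx t ht l hl)
    (h.oracles.uniform t ht l hl) (h.oracles.indep t ht l hl) hmeas hint
  have e : ∀ ω, inner ℝ (liftedReward M (R.trueGrad F L t l ω) (R.x L t l ω))
      ((1 / (k : ℝ)) • ∑ j, lift M (R.pts t l ω j))
      = (1 / (k : ℝ)) * ∑ j, φ (R.x L t l ω) (R.pts t l ω j) := by
    intro ω
    rw [inner_smul_right, inner_sum]
    rfl
  simp_rw [e]
  refine ⟨?_, (integrable_finsetSum _ fun j _ => hint j).const_mul _, hmain⟩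
  exact Integrable.of_bound
    (((h.x_countablyMeasurable_self ht hl.le).comp₂ hu φ).measurable.aestronglyMeasurable) _
    (Filter.Eventually.of_forall fun ω => hb ω _ (h.u_mem ht hl ω))

lemma integrable_norm_noise (h : Setting R μ K F T L G β σ c) {t l : ℕ} (ht : t < T)
    (hl : l ≤ L) : Integrable (fun ω => ‖R.noise F L t l ω‖) μ :=
  ((h.memLp_noise ht hl).integrable (by norm_num)).norm

lemma integrable_norm_lag (h : Setting R μ K F T L G β σ c) {t l : ℕ} (ht : t < T)
    (hl : l < L) : Integrable (fun ω => ‖R.lag F L t l ω‖) μ :=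
  ((h.memLp_lag ht hl).integrable (by norm_num)).norm

lemma integrable_norm_trueGrad_sub (h : Setting R μ K F T L G β σ c) {t l : ℕ} (ht : t < T)
    (hl : l < L) :
    Integrable (fun ω => ‖R.trueGrad F L t (l + 1) ω - R.trueGrad F L t l ω‖) μ :=
  (((h.memLp_trueGrad ht hl).sub (h.memLp_trueGrad ht hl.le)).integrable (by norm_num)).norm

lemma integrable_gradLoss (h : Setting R μ K F T L G β σ c) {t l : ℕ} (ht : t < T)
    (hl : l < L) : Integrable (R.gradLoss K F L t l) μ :=
  ((h.integrable_norm_noise ht hl).const_mul _).add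
    (((h.integrable_norm_lag ht hl).const_mul _).add
      ((h.integrable_norm_trueGrad_sub ht hl).const_mul _))

lemma integral_progress (h : Setting R μ K F T L G β σ c) {t l : ℕ} (ht : t < T) (hl : l < L)
    {xs : Vec n} (hxs : xs ∈ K) :
    1 / (L : ℝ) * ((1 - 1 / (L : ℝ)) ^ l * F t xs - ∫ ω, F t (R.x L t l ω) ∂μ
      - (6 * G * √n / M + 2 * G * (1 / √(T : ℝ)))
      - ∫ ω, inner ℝ (R.reward L t l ω) (lift M (roundDown M xs) - R.y t l ω) ∂μ
      - ∫ ω, R.gradLoss K F L t l ω ∂μ)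
      ≤ ∫ ω, F t (R.x L t (l + 1) ω) ∂μ - ∫ ω, F t (R.x L t l ω) ∂μ := by
  have hL : (1 : ℝ) ≤ L := by exact_mod_cast h.one_le_L
  have hL1 : 1 / (L : ℝ) ≤ 1 := by rw [div_le_one (by linarith)]; exact hL
  have hL0 : 0 ≤ 1 / (L : ℝ) := by positivity
  have hD : 0 ≤ Metric.diam K := Metric.diam_nonneg
  obtain ⟨i4, i5, hz⟩ := h.integral_rounding ht hl
  have i0 := h.integrable_reward_value ht hl
  have i1 := h.integrable_reward_value ht hl.le
  have i2 := h.integrable_inner_reward ht hl (lift M (roundDown M xs))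
  have i3 := h.integrable_gradLoss ht hl
  have hpath : ∀ ω, 1 / (L : ℝ) * ((1 - 1 / (L : ℝ)) ^ l * F t xs
      - (6 * G * √n / M + 2 * G * (1 / √(T : ℝ))) - F t (R.x L t l ω)
      - inner ℝ (R.reward L t l ω) (lift M (roundDown M xs) - R.y t l ω) - R.gradLoss K F L t l ω
      + (inner ℝ (liftedReward M (R.trueGrad F L t l ω) (R.x L t l ω)) (lift M (R.u t l ω))
        - inner ℝ (liftedReward M (R.trueGrad F L t l ω) (R.x L t l ω))
          ((1 / (k : ℝ)) • ∑ j, lift M (R.pts t l ω j))))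
      ≤ F t (R.x L t (l + 1) ω) - F t (R.x L t l ω) := by
    intro ω
    refine le_trans (mul_le_mul_of_nonneg_left ?_ hL0)
      ((h.reward t ht).progress h.G_nonneg h.one_le_M h.nonempty h.subset_cube h.downClosed
        h.one_le_L (d := R.d t (l + 1) ω) (h.x_mem ht hl.le ω) (h.u_mem ht hl ω) hxs
        (q := (1 - 1 / (L : ℝ)) ^ l) (pow_nonneg (by linarith) _)
        (pow_le_one₀ (by linarith) (by linarith))
        (iter_le_one_sub_pow h.one_le_L (fun j hj => h.subset_cube (h.u_mem ht hj ω).1) l hl.le)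
        (iter_succ_sub l) (h.x_mem ht hl ω) (h.y_mem ht hl ω) (h.oracles.round t ht l hl ω))
    have hδ : ‖R.d t (l + 1) ω - R.trueGrad F L t l ω‖
        ≤ ‖R.noise F L t (l + 1) ω‖ + ‖R.lag F L t l ω‖ := by
      rw [R.d_eq F L t (l + 1), add_comm ‖R.noise F L t (l + 1) ω‖, add_sub_right_comm]
      exact norm_add_le _ _
    have hδ' := mul_le_mul_of_nonneg_left hδ (mul_nonneg zero_le_two hD)
    simp only [Run.gradLoss, Run.reward]
    change _ ≤ _ - 2 * Metric.diam K * ‖R.d t (l + 1) ω - R.trueGrad F L t l ω‖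
      - Metric.diam K * ‖R.trueGrad F L t (l + 1) ω - R.trueGrad F L t l ω‖ + _
    simp only [Run.trueGrad] at *
    linarith
  have j0 := integrable_fun_sub (integrable_const (μ := μ) ((1 - 1 / (L : ℝ)) ^ l * F t xs
    - (6 * G * √n / M + 2 * G * (1 / √(T : ℝ))))) i1
  have j1 := integrable_fun_sub j0 i2
  have j2 := integrable_fun_sub j1 i3
  have j3 := integrable_fun_sub i4 i5
  have hmono := integral_mono ((j2.fun_add j3).const_mul (1 / (L : ℝ)))
    (integrable_fun_sub i0 i1) hpath
  rw [integral_const_mul, integral_add j2 j3, integral_sub i4 i5, hz, sub_self, add_zero,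
    integral_sub j1 i3, integral_sub j0 i2, integral_sub (integrable_const _) i1,
    integral_sub i0 i1] at hmono
  simp only [integral_const, probReal_univ, one_smul] at hmono
  refine le_trans (le_of_eq ?_) hmono
  ring

end Setting

lemma cubeRoot_pow {x : ℝ} (hx : 0 ≤ x) : (x ^ (1 / 3 : ℝ)) ^ 3 = x := by
  rw [← Real.rpow_natCast, ← Real.rpow_mul hx]; norm_num

lemma cubeRoot_sq {x : ℝ} (hx : 0 ≤ x) : x ^ (2 / 3 : ℝ) = (x ^ (1 / 3 : ℝ)) ^ 2 := by
  rw [← Real.rpow_natCast, ← Real.rpow_mul hx]; norm_num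

namespace Setting

variable {n M k : ℕ} {Ω : Type*} [mΩ : MeasurableSpace Ω] {R : Run n M k Ω} {μ : Measure Ω}
  {K : Set (Vec n)} {F : ℕ → Vec n → ℝ} {T L : ℕ} {G β σ c : ℝ}

variable [IsProbabilityMeasure μ]

lemma sum_integral_gradLoss_le (h : Setting R μ K F T L G β σ c) {t : ℕ} (ht : t < T) {S : ℝ}
    (hS : ∀ ω, ∑ l ∈ Finset.range L, ‖R.trueGrad F L t (l + 1) ω - R.trueGrad F L t l ω‖ ≤ S) :
    ∑ l ∈ Finset.range L, ∫ ω, R.gradLoss K F L t l ω ∂μ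
      ≤ Metric.diam K * ((L : ℝ) ^ (1 / 3 : ℝ)) ^ 2 * (14 * σ + 8 * G + 5 * S) := by
  have hD : 0 ≤ Metric.diam K := Metric.diam_nonneg
  have hσ := h.σ_nonneg
  have hG := h.G_nonneg
  have hL : (1 : ℝ) ≤ L := by exact_mod_cast h.one_le_L
  set r := (L : ℝ) ^ (1 / 3 : ℝ) with hr
  have hr3 : r ^ 3 = L := cubeRoot_pow (by linarith)
  have hr1 : 1 ≤ r := Real.one_le_rpow hL (by norm_num)
  have hS0 : 0 ≤ S := by
    obtain ⟨ω⟩ : Nonempty Ω := nonempty_of_isProbabilityMeasure μ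
    exact (Finset.sum_nonneg fun _ _ => norm_nonneg _).trans (hS ω)
  have e : ∀ l ∈ Finset.range L, ∫ ω, R.gradLoss K F L t l ω ∂μ
      = 2 * Metric.diam K * ∫ ω, ‖R.noise F L t (l + 1) ω‖ ∂μ
        + ∫ ω, (2 * Metric.diam K * ‖R.lag F L t l ω‖
          + Metric.diam K * ‖R.trueGrad F L t (l + 1) ω - R.trueGrad F L t l ω‖) ∂μ := by
    intro l hl
    have hl' := Finset.mem_range.1 hl
    simp only [Run.gradLoss]
    rw [integral_add ((h.integrable_norm_noise ht hl').const_mul _)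
      (((h.integrable_norm_lag ht hl').const_mul _).fun_add
      ((h.integrable_norm_trueGrad_sub ht hl').const_mul _)), integral_const_mul]
  rw [Finset.sum_congr rfl e, Finset.sum_add_distrib, ← Finset.mul_sum]
  have h1 : ∑ l ∈ Finset.range L, ∫ ω, ‖R.noise F L t (l + 1) ω‖ ∂μ ≤ 7 * σ * r ^ 2 := by
    -- The standard deviations are summed by the inequality `√(2ρ) ≤ rρ + 1/(2r)`.
    have h2 : ∀ l ∈ Finset.range L, ∫ ω, ‖R.noise F L t (l + 1) ω‖ ∂μ
        ≤ σ * (r * rho (l + 1) + 1 / (2 * r)) := by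
      intro l hl
      have hρ := rho_pos (l + 1)
      refine (h.integral_norm_noise_le ht (Finset.mem_range.1 hl)).trans
        (mul_le_mul_of_nonneg_left ?_ hσ)
      rw [Real.sqrt_le_left (by positivity)]
      have e1 : (r * rho (l + 1) + 1 / (2 * r)) ^ 2
          = 2 * rho (l + 1) + (r * rho (l + 1) - 1 / (2 * r)) ^ 2 := by
        field_simp; ring
      rw [e1]
      linarith [sq_nonneg (r * rho (l + 1) - 1 / (2 * r))]
    refine (Finset.sum_le_sum h2).trans ?_
    rw [← Finset.mul_sum, Finset.sum_add_distrib, ← Finset.mul_sum]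
    have h3 := mul_le_mul_of_nonneg_left (sum_rho_le L) (by linarith : 0 ≤ r)
    simp only [Finset.sum_const, Finset.card_range, nsmul_eq_mul]
    have h4 : (L : ℝ) * (1 / (2 * r)) = r ^ 2 / 2 := by
      rw [← hr3]; field_simp
    rw [h4]
    have h5 : r * ∑ i ∈ Finset.range L, rho (i + 1) + r ^ 2 / 2 ≤ 7 * r ^ 2 := by
      nlinarith
    calc _ ≤ σ * (7 * r ^ 2) := mul_le_mul_of_nonneg_left h5 hσ
      _ = _ := by ring
  have h2 : ∑ l ∈ Finset.range L, ∫ ω, (2 * Metric.diam K * ‖R.lag F L t l ω‖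
      + Metric.diam K * ‖R.trueGrad F L t (l + 1) ω - R.trueGrad F L t l ω‖) ∂μ
      ≤ Metric.diam K * r ^ 2 * (8 * G + 5 * S) := by
    have hint : ∀ l ∈ Finset.range L, Integrable (fun ω => 2 * Metric.diam K * ‖R.lag F L t l ω‖
        + Metric.diam K * ‖R.trueGrad F L t (l + 1) ω - R.trueGrad F L t l ω‖) μ := by
      intro l hl
      have hl' := Finset.mem_range.1 hl
      exact ((h.integrable_norm_lag ht hl').const_mul _).add
        ((h.integrable_norm_trueGrad_sub ht hl').const_mul _)
    rw [← integral_finsetSum _ hint]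
    have hb : ∀ ω, ∑ l ∈ Finset.range L, (2 * Metric.diam K * ‖R.lag F L t l ω‖
        + Metric.diam K * ‖R.trueGrad F L t (l + 1) ω - R.trueGrad F L t l ω‖)
        ≤ Metric.diam K * r ^ 2 * (8 * G + 5 * S) := by
      intro ω
      rw [Finset.sum_add_distrib, ← Finset.mul_sum, ← Finset.mul_sum]
      have h3 := sum_norm_avgGrad_sub_le (fun j => R.trueGrad F L t j ω) h.one_le_L
        (h.norm_trueGrad_le ht (Nat.zero_le _) ω) (hS ω)
      have h4 : ∑ l ∈ Finset.range L, ‖R.lag F L t l ω‖ ≤ (2 * G + S) * (2 * r ^ 2) := by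
        refine h3.trans (mul_le_mul_of_nonneg_left ?_ (by positivity))
        rw [hr, ← cubeRoot_sq (by linarith)]
        exact inv_rho_le h.one_le_L
      have h5 : S ≤ r ^ 2 * S := le_mul_of_one_le_left hS0 (one_le_pow₀ hr1)
      have h6 := mul_le_mul_of_nonneg_left h4 (mul_nonneg zero_le_two hD)
      have h7 := mul_le_mul_of_nonneg_left ((hS ω).trans h5) hD
      linarith
    refine (integral_mono (integrable_finsetSum _ hint) (integrable_const _) hb).trans ?_
    simp
  have h3 := mul_le_mul_of_nonneg_left h1 (mul_nonneg zero_le_two hD)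
  linarith

/-- The bound before the lattice parameter is chosen, for noise that does not dominate. It holds
with any bound `S` on the total variation of the exact gradients along the iterates. -/
lemma sum_integral_ge_of_noise_le (h : Setting R μ K F T L G β σ c) (hn : 1 ≤ n) (hG : 0 < G)
    (hσ : σ ≤ G * (L : ℝ) ^ (1 / 3 : ℝ)) {S : ℝ} (hS0 : 0 ≤ S)
    (hS : ∀ t < T, ∀ ω,
      ∑ l ∈ Finset.range L, ‖R.trueGrad F L t (l + 1) ω - R.trueGrad F L t l ω‖ ≤ S)
    {xs : Vec n} (hxs : xs ∈ K) :
    1 / Real.exp 1 * ∑ t ∈ Finset.range T, F t xs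
      - (T * (6 * G * √n / M + 2 * G * (1 / √(T : ℝ))) + (c + 17) * (n * M * G * √(T : ℝ))
        + Metric.diam K * T / (L : ℝ) ^ (1 / 3 : ℝ) * (14 * σ + 8 * G + 5 * S))
      ≤ ∑ t ∈ Finset.range T, ∫ ω, F t (R.x L t L ω) ∂μ := by
  have hD : 0 ≤ Metric.diam K := Metric.diam_nonneg
  have hσ0 := h.σ_nonneg
  have hc := h.c_nonneg
  have hL : (1 : ℝ) ≤ L := by exact_mod_cast h.one_le_L
  have hM : (1 : ℝ) ≤ M := by exact_mod_cast h.one_le_M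
  have hT : (1 : ℝ) ≤ T := by exact_mod_cast h.one_le_T
  have hn' : (1 : ℝ) ≤ n := by exact_mod_cast hn
  set r := (L : ℝ) ^ (1 / 3 : ℝ) with hr
  have hr3 : r ^ 3 = L := cubeRoot_pow (by linarith)
  have hr1 : 1 ≤ r := Real.one_le_rpow hL (by norm_num)
  set c₀ := 6 * G * √n / M + 2 * G * (1 / √(T : ℝ)) with hc₀
  set B : ℕ → ℝ := fun l => c * n * M * G * √(T : ℝ) + (√((n : ℝ) * M) * G * √(T : ℝ) / 2
        + √((n : ℝ) * M) / (G * √(T : ℝ)) / 2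
          * (T * ((8 * G ^ 2 + 4 * σ ^ 2 * rho (l + 1)) / M))) with hB
  set W : ℕ → ℝ := fun l => ∑ t ∈ Finset.range T, ∫ ω, R.gradLoss K F L t l ω ∂μ with hW
  have hrange : ∀ {t}, t ∈ Finset.range T → t < T := fun ht => Finset.mem_range.1 ht
  have hA : 0 ≤ ∑ t ∈ Finset.range T, F t xs :=
    Finset.sum_nonneg fun t ht => (h.reward t (hrange ht)).nonneg _ (h.subset_cube hxs)
  have hz : lift M (roundDown M xs) ∈ liftedSet M K :=
    ⟨_, roundDown_mem h.one_le_M h.subset_cube h.downClosed hxs, rfl⟩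
  have hW0 : ∀ l, 0 ≤ W l := fun l => Finset.sum_nonneg fun t _ => integral_nonneg fun ω => by
    simp only [Run.gradLoss]; positivity
  have main := frankWolfe_unroll h.one_le_L
    (a := fun l => ∑ t ∈ Finset.range T, ∫ ω, F t (R.x L t l ω) ∂μ)
    (e := fun l => T * c₀ + B l + W l) hA
    (Finset.sum_nonneg fun t ht => integral_nonneg fun ω =>
      (h.reward t (hrange ht)).nonneg _ (h.x_mem_cube (hrange ht) (Nat.zero_le _) ω))
    (fun l _ => by
      have := hW0 l
      have := rho_pos (l + 1)
      positivity)
    (fun l hl => by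
      have h1 := Finset.sum_le_sum fun t (ht : t ∈ Finset.range T) =>
        h.integral_progress (hrange ht) hl hxs
      have h2 := h.regret_le hn hG hl hz
      rw [← Finset.mul_sum, Finset.sum_sub_distrib, Finset.sum_sub_distrib,
        Finset.sum_sub_distrib, Finset.sum_sub_distrib, Finset.sum_sub_distrib,
        ← Finset.mul_sum, Finset.sum_const, Finset.card_range, nsmul_eq_mul] at h1
      refine le_trans (mul_le_mul_of_nonneg_left ?_ (by positivity)) h1
      simp only [hB, hW, hc₀]
      linarith)
  refine le_trans (sub_le_sub_left ?_ _) main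
  rw [Finset.sum_add_distrib, Finset.sum_add_distrib, Finset.sum_const, Finset.card_range,
    nsmul_eq_mul, mul_add, mul_add]
  have e1 : 1 / (L : ℝ) * (L * (T * c₀)) = T * c₀ := by field_simp
  have b1 : 1 / (L : ℝ) * ∑ l ∈ Finset.range L, B l ≤ (c + 17) * (n * M * G * √(T : ℝ)) := by
    set s := √((n : ℝ) * M) with hs
    have hs2 : s * s = n * M := Real.mul_self_sqrt (by positivity)
    have hs1 : 1 ≤ s := Real.one_le_sqrt.2 (by nlinarith)
    have hq2 : √(T : ℝ) * √(T : ℝ) = T := Real.mul_self_sqrt (by positivity)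
    have hq1 : 1 ≤ √(T : ℝ) := Real.one_le_sqrt.2 hT
    have e2 : ∑ l ∈ Finset.range L, B l = L * (c * n * M * G * √(T : ℝ) + s * G * √(T : ℝ) / 2)
        + s / (G * √(T : ℝ)) / 2 * (T / M) * (L * (8 * G ^ 2)
          + 4 * σ ^ 2 * ∑ l ∈ Finset.range L, rho (l + 1)) := by
      have : ∀ l, B l = (c * n * M * G * √(T : ℝ) + s * G * √(T : ℝ) / 2)
          + s / (G * √(T : ℝ)) / 2 * (T / M) * (8 * G ^ 2 + 4 * σ ^ 2 * rho (l + 1)) := by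
        intro l; simp only [hB]; ring
      simp_rw [this]
      rw [Finset.sum_add_distrib, Finset.sum_const, Finset.card_range, nsmul_eq_mul,
        ← Finset.mul_sum, Finset.sum_add_distrib, Finset.sum_const, Finset.card_range,
        nsmul_eq_mul, ← Finset.mul_sum]
    have hρ0 : 0 ≤ ∑ l ∈ Finset.range L, rho (l + 1) :=
      Finset.sum_nonneg fun l _ => (rho_pos _).le
    have h3 : 4 * σ ^ 2 * ∑ l ∈ Finset.range L, rho (l + 1) ≤ L * (24 * G ^ 2) := by
      have h4 : σ ^ 2 ≤ (G * r) ^ 2 := pow_le_pow_left₀ hσ0 hσ 2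
      calc _ ≤ 4 * (G * r) ^ 2 * (6 * r) := by
            gcongr
            exact sum_rho_le L
        _ = r ^ 3 * (24 * G ^ 2) := by ring
        _ = _ := by rw [hr3]
    have h4 : s / (G * √(T : ℝ)) / 2 * (T / M) * (L * (8 * G ^ 2)
        + 4 * σ ^ 2 * ∑ l ∈ Finset.range L, rho (l + 1))
        ≤ L * (16 * (s * G * √(T : ℝ))) := by
      calc _ ≤ s / (G * √(T : ℝ)) / 2 * (T / 1) * (L * (8 * G ^ 2) + L * (24 * G ^ 2)) := by
            refine mul_le_mul (by gcongr) (by linarith)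
              (add_nonneg (by positivity) (mul_nonneg (by positivity) hρ0)) (by positivity)
        _ = L * (16 * (s * G * √(T : ℝ))) := by
            nth_rewrite 2 [← hq2]
            field_simp
            ring
    have h5 : s * G * √(T : ℝ) ≤ n * M * G * √(T : ℝ) := by
      rw [← hs2]
      gcongr
      nlinarith
    have h6 : 0 ≤ n * M * G * √(T : ℝ) := by positivity
    rw [e2, one_div, inv_mul_le_iff₀ (by linarith)]
    calc _ ≤ L * (c * n * M * G * √(T : ℝ) + s * G * √(T : ℝ) / 2)
          + L * (16 * (s * G * √(T : ℝ))) := by linarith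
      _ = L * (c * (n * M * G * √(T : ℝ)) + 33 / 2 * (s * G * √(T : ℝ))) := by ring
      _ ≤ _ := by
        refine mul_le_mul_of_nonneg_left ?_ (by linarith)
        linarith
  have b2 : 1 / (L : ℝ) * ∑ l ∈ Finset.range L, W l
      ≤ Metric.diam K * T / r * (14 * σ + 8 * G + 5 * S) := by
    have h3 : ∑ l ∈ Finset.range L, W l
        ≤ ∑ _t ∈ Finset.range T, Metric.diam K * r ^ 2 * (14 * σ + 8 * G + 5 * S) := by
      simp only [hW]
      rw [Finset.sum_comm]
      exact Finset.sum_le_sum fun t ht => h.sum_integral_gradLoss_le (hrange ht)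
        (hS t (hrange ht))
    rw [Finset.sum_const, Finset.card_range, nsmul_eq_mul] at h3
    rw [one_div, inv_mul_le_iff₀ (by linarith)]
    refine h3.trans (le_of_eq ?_)
    rw [← hr3]
    field_simp
  rw [e1]
  linarith

lemma sum_integral_ge_trivial (h : Setting R μ K F T L G β σ c) {xs : Vec n} (hxs : xs ∈ K) :
    ∑ t ∈ Finset.range T, F t xs - G * Metric.diam K * T
      ≤ ∑ t ∈ Finset.range T, ∫ ω, F t (R.x L t L ω) ∂μ := by
  have h1 : ∀ t ∈ Finset.range T, F t xs - G * Metric.diam K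
      ≤ ∫ ω, F t (R.x L t L ω) ∂μ := by
    intro t ht
    have ht' := Finset.mem_range.1 ht
    have h2 := integral_mono (integrable_const (μ := μ) (F t xs - G * Metric.diam K))
      (h.integrable_reward_value ht' le_rfl) (fun ω => by
        have hx := h.x_mem ht' le_rfl ω
        have h3 := (abs_le.1 ((h.reward t ht').lipschitz _ (h.subset_cube hxs) _
          (h.subset_cube hx))).2
        have h4 := mul_le_mul_of_nonneg_left (norm_sub_le_diam h.subset_cube hxs hx) h.G_nonneg
        simp only
        linarith)
    simpa using h2
  refine le_trans (le_of_eq ?_) (Finset.sum_le_sum h1)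
  rw [Finset.sum_sub_distrib, Finset.sum_const, Finset.card_range, nsmul_eq_mul]
  ring

end Setting

lemma one_le_latticeParam {n T : ℕ} (hn : 1 ≤ n) (hT : 1 ≤ T) : 1 ≤ latticeParam n T := by
  have h1 : (0 : ℝ) < n := by exact_mod_cast hn
  have h2 : (0 : ℝ) < T := by exact_mod_cast hT
  exact Nat.one_le_iff_ne_zero.2 (Nat.ceil_pos.2 (by positivity)).ne'

/-- The choice of the lattice balances the rounding error against the regret; with fewer than `n`
rounds the lattice has a single step per coordinate, and the second estimate can fail. -/
lemma latticeParam_bounds {n T : ℕ} (hn : 1 ≤ n) (hT : n ≤ T) :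
    T * (√n / latticeParam n T) ≤ (n : ℝ) ^ (3 / 4 : ℝ) * (T : ℝ) ^ (3 / 4 : ℝ) ∧
    n * latticeParam n T * √(T : ℝ) ≤ 2 * ((n : ℝ) ^ (3 / 4 : ℝ) * (T : ℝ) ^ (3 / 4 : ℝ)) ∧
    √(T : ℝ) ≤ (n : ℝ) ^ (3 / 4 : ℝ) * (T : ℝ) ^ (3 / 4 : ℝ) := by
  have h1 : (1 : ℝ) ≤ n := by exact_mod_cast hn
  have h2 : (n : ℝ) ≤ T := by exact_mod_cast hT
  have p4 : ∀ x : ℝ, 0 ≤ x → (x ^ (1 / 4 : ℝ)) ^ 4 = x := fun x hx => by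
    rw [← Real.rpow_natCast, ← Real.rpow_mul hx]; norm_num
  have p3 : ∀ x : ℝ, 0 ≤ x → x ^ (3 / 4 : ℝ) = (x ^ (1 / 4 : ℝ)) ^ 3 := fun x hx => by
    rw [← Real.rpow_natCast, ← Real.rpow_mul hx]; norm_num
  have p2 : ∀ x : ℝ, 0 ≤ x → √x = (x ^ (1 / 4 : ℝ)) ^ 2 := fun x hx => by
    rw [Real.sqrt_eq_rpow, ← Real.rpow_natCast, ← Real.rpow_mul hx]; norm_num
  set p := (n : ℝ) ^ (1 / 4 : ℝ) with hp
  set s := (T : ℝ) ^ (1 / 4 : ℝ) with hs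
  have hp1 : 1 ≤ p := Real.one_le_rpow h1 (by norm_num)
  have hps : p ≤ s := Real.rpow_le_rpow (by linarith) h2 (by norm_num)
  have hsp : ((T : ℝ) / n) ^ (1 / 4 : ℝ) = s / p := Real.div_rpow (by linarith) (by linarith) _
  have hsp1 : 1 ≤ s / p := by rw [le_div_iff₀ (by linarith)]; linarith
  have m1 : s / p ≤ latticeParam n T := by rw [← hsp]; exact Nat.le_ceil _
  have m2 : (latticeParam n T : ℝ) ≤ 2 * (s / p) := by
    have := (Nat.ceil_lt_add_one (by rw [hsp]; linarith : 0 ≤ ((T : ℝ) / n) ^ (1 / 4 : ℝ))).le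
    rw [hsp] at this
    have e : (latticeParam n T : ℝ) = (⌈((T : ℝ) / n) ^ (1 / 4 : ℝ)⌉₊ : ℝ) := rfl
    rw [e, hsp]; linarith
  rw [p3 n (by linarith), p3 T (by linarith), p2 n (by linarith), p2 T (by linarith), ← hp, ← hs]
  have hn4 : (n : ℝ) = p ^ 4 := (p4 n (by linarith)).symm
  have hT4 : (T : ℝ) = s ^ 4 := (p4 T (by linarith)).symm
  refine ⟨?_, ?_, ?_⟩
  · calc (T : ℝ) * (p ^ 2 / latticeParam n T) ≤ T * (p ^ 2 / (s / p)) := by gcongr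
      _ = p ^ 3 * s ^ 3 := by rw [hT4]; field_simp
  · calc (n : ℝ) * latticeParam n T * s ^ 2 ≤ n * (2 * (s / p)) * s ^ 2 := by gcongr
      _ = 2 * (p ^ 3 * s ^ 3) := by rw [hn4]; field_simp
  · calc s ^ 2 ≤ s ^ 3 := pow_le_pow_right₀ (by linarith) (by norm_num)
      _ ≤ p ^ 3 * s ^ 3 := le_mul_of_one_le_left (by positivity) (one_le_pow₀ hp1)

/-- The bound in terms of the total variation `S` of the gradients along the iterates. If there are
fewer than `n` rounds, or if the noise dominates, then it follows from the Lipschitz condition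
alone. -/
lemma Setting.sum_integral_ge {n T k L : ℕ} {Ω : Type*} [MeasurableSpace Ω]
    {R : Run n (latticeParam n T) k Ω} {μ : Measure Ω} [IsProbabilityMeasure μ] {K : Set (Vec n)}
    {F : ℕ → Vec n → ℝ} {G β σ c : ℝ} (h : Setting R μ K F T L G β σ c) (hn : 1 ≤ n) {S : ℝ}
    (hS0 : 0 ≤ S) (hS : ∀ t < T, ∀ ω,
      ∑ l ∈ Finset.range L, ‖R.trueGrad F L t (l + 1) ω - R.trueGrad F L t l ω‖ ≤ S)
    {xs : Vec n} (hxs : xs ∈ K) :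
    1 / Real.exp 1 * ∑ t ∈ Finset.range T, F t xs
      - (42 + 2 * c) * ((n : ℝ) ^ (3 / 4 : ℝ) * G * (T : ℝ) ^ (3 / 4 : ℝ))
      - 14 * ((S + G + σ) * Metric.diam K * T / (L : ℝ) ^ (1 / 3 : ℝ))
      ≤ ∑ t ∈ Finset.range T, ∫ ω, F t (R.x L t L ω) ∂μ := by
  have hD : 0 ≤ Metric.diam K := Metric.diam_nonneg
  have hσ0 := h.σ_nonneg
  have hc := h.c_nonneg
  have hG := h.G_nonneg
  have hL : (1 : ℝ) ≤ L := by exact_mod_cast h.one_le_L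
  have hT : (1 : ℝ) ≤ T := by exact_mod_cast h.one_le_T
  have hn' : (1 : ℝ) ≤ n := by exact_mod_cast hn
  set r := (L : ℝ) ^ (1 / 3 : ℝ) with hr
  have hr1 : 1 ≤ r := Real.one_le_rpow hL (by norm_num)
  set P := (n : ℝ) ^ (3 / 4 : ℝ) * (T : ℝ) ^ (3 / 4 : ℝ) with hP
  have hP0 : 0 ≤ P := by positivity
  have eP : (n : ℝ) ^ (3 / 4 : ℝ) * G * (T : ℝ) ^ (3 / 4 : ℝ) = G * P := by rw [hP]; ring
  rw [eP]
  have hA : 0 ≤ ∑ t ∈ Finset.range T, F t xs := Finset.sum_nonneg fun t ht =>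
    (h.reward t (Finset.mem_range.1 ht)).nonneg _ (h.subset_cube hxs)
  have hAe : 1 / Real.exp 1 * ∑ t ∈ Finset.range T, F t xs ≤ ∑ t ∈ Finset.range T, F t xs := by
    refine mul_le_of_le_one_left hA ?_
    rw [div_le_one (Real.exp_pos 1)]
    exact Real.one_le_exp zero_le_one
  have htriv := h.sum_integral_ge_trivial hxs
  have hGP : 0 ≤ G * P := by positivity
  have hcGP : 0 ≤ c * (G * P) := by positivity
  have hX : 0 ≤ (S + G + σ) * Metric.diam K * T / r := by positivity
  rcases lt_or_ge T n with hTn | hTn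
  · have h1 : G * Metric.diam K * T ≤ G * P := by
      rw [mul_assoc]
      refine mul_le_mul_of_nonneg_left ?_ hG
      have h2 : (T : ℝ) ≤ n := by exact_mod_cast hTn.le
      have h3 : (T : ℝ) = (T : ℝ) ^ (1 / 4 : ℝ) * (T : ℝ) ^ (3 / 4 : ℝ) := by
        rw [← Real.rpow_add (by linarith)]; norm_num
      have h4 : √(n : ℝ) * (n : ℝ) ^ (1 / 4 : ℝ) = (n : ℝ) ^ (3 / 4 : ℝ) := by
        rw [Real.sqrt_eq_rpow, ← Real.rpow_add (by linarith)]; norm_num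
      calc Metric.diam K * T ≤ √n * T := by gcongr; exact diam_le_sqrt h.subset_cube
        _ = √n * (T : ℝ) ^ (1 / 4 : ℝ) * (T : ℝ) ^ (3 / 4 : ℝ) := by
            rw [mul_assoc, ← h3]
        _ ≤ √n * (n : ℝ) ^ (1 / 4 : ℝ) * (T : ℝ) ^ (3 / 4 : ℝ) := by gcongr
        _ = P := by rw [h4]
    linarith
  rcases le_or_gt (G * r) σ with hσ | hσ
  · have h1 : G * Metric.diam K * T ≤ (S + G + σ) * Metric.diam K * T / r := by
      rw [le_div_iff₀ (by linarith)]
      calc G * Metric.diam K * T * r = G * r * (Metric.diam K * T) := by ring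
        _ ≤ (S + G + σ) * (Metric.diam K * T) := by gcongr; linarith
        _ = _ := by ring
    linarith
  · have hG0 : 0 < G := by
      rcases eq_or_lt_of_le hG with h0 | h0
      · rw [← h0] at hσ; linarith
      · exact h0
    have main := h.sum_integral_ge_of_noise_le hn hG0 hσ.le hS0 hS hxs
    obtain ⟨b1, b2, b3⟩ := latticeParam_bounds hn hTn
    rw [← hP] at b1 b2 b3
    refine le_trans ?_ main
    have e1 : T * (6 * G * √n / latticeParam n T + 2 * G * (1 / √(T : ℝ)))
        = 6 * (G * (T * (√n / latticeParam n T))) + 2 * (G * √(T : ℝ)) := by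
      have hq2 : √(T : ℝ) * √(T : ℝ) = T := Real.mul_self_sqrt (by positivity)
      have : T * (1 / √(T : ℝ)) = √(T : ℝ) := by
        rw [mul_one_div, Real.div_sqrt]
      calc _ = 6 * (G * (T * (√n / latticeParam n T))) + 2 * (G * (T * (1 / √(T : ℝ)))) := by
            ring
        _ = _ := by rw [this]
    have e2 : (c + 17) * (n * latticeParam n T * G * √(T : ℝ))
        = (c + 17) * (G * (n * latticeParam n T * √(T : ℝ))) := by ring
    have d1 := mul_le_mul_of_nonneg_left b1 hG
    have d2 := mul_le_mul_of_nonneg_left (mul_le_mul_of_nonneg_left b2 hG)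
      (by linarith : 0 ≤ c + 17)
    have d3 := mul_le_mul_of_nonneg_left b3 hG
    have d4 : Metric.diam K * T / r * (14 * σ + 8 * G + 5 * S)
        ≤ 14 * ((S + G + σ) * Metric.diam K * T / r) := by
      have : 0 ≤ Metric.diam K * T / r := by positivity
      calc _ ≤ Metric.diam K * T / r * (14 * (S + G + σ)) := by gcongr; linarith
        _ = _ := by ring
    rw [e1, e2]
    linarith

end OnlineDR

theorem mainTheorem1 (c : ℝ) (hc : 0 ≤ c) :
    ∃ C : ℝ, 0 < C ∧
      ∀ (n T L k : ℕ), 1 ≤ n → 1 ≤ T → 1 ≤ L → 1 ≤ k →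
      ∀ K : Set (OnlineDR.Vec n), K.Nonempty → K ⊆ OnlineDR.cube n → Convex ℝ K →
        OnlineDR.DownClosed K →
      ∀ G β σ : ℝ, 0 ≤ G → 0 ≤ β → 0 ≤ σ →
      ∀ F : ℕ → OnlineDR.Vec n → ℝ, (∀ t < T, OnlineDR.IsReward K G β (F t)) →
      ∀ (Ω : Type*) [MeasurableSpace Ω] (μ : Measure Ω) [IsProbabilityMeasure μ]
        (R : OnlineDR.Run n (OnlineDR.latticeParam n T) k Ω),
        R.VeeOracles μ K T L G c → R.StochasticGradients μ F T L σ →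
      (∀ t < T, Integrable (fun ω => F t (R.x L t L ω)) μ) ∧
      (∀ xs ∈ K,
        ∑ t ∈ Finset.range T, ∫ ω, F t (R.x L t L ω) ∂μ ≥
          (1 / Real.exp 1 - C / L) * ∑ t ∈ Finset.range T, F t xs
          - C * ((n : ℝ) ^ (3 / 4 : ℝ) * G * (T : ℝ) ^ (3 / 4 : ℝ))
          - C * ((β * Metric.diam K + G + σ) * Metric.diam K * T / (L : ℝ) ^ (1 / 3 : ℝ))) ∧
      (L = ⌈(T : ℝ) ^ (3 / 4 : ℝ)⌉₊ → ∀ xs ∈ K,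
        ∑ t ∈ Finset.range T, ∫ ω, F t (R.x L t L ω) ∂μ ≥
          (1 / Real.exp 1 - C / (T : ℝ) ^ (3 / 4 : ℝ)) * ∑ t ∈ Finset.range T, F t xs
          - C * ((G + σ) * (n : ℝ) ^ (5 / 4 : ℝ) * (T : ℝ) ^ (3 / 4 : ℝ))) := by
  refine ⟨112 + 2 * c, by positivity, ?_⟩
  intro n T L k hn hT hL _ K hne hK hconv hdown G β σ hG hβ hσ F hF Ω _ μ _ R hO hg
  have h : OnlineDR.Setting R μ K F T L G β σ c :=
    ⟨OnlineDR.one_le_latticeParam hn hT, hT, hL, hne, hK, hconv, hdown, hG, hσ, hc, hF, hO, hg⟩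
  have hD : 0 ≤ Metric.diam K := Metric.diam_nonneg
  have hL' : (1 : ℝ) ≤ L := by exact_mod_cast hL
  have hT' : (1 : ℝ) ≤ T := by exact_mod_cast hT
  have hn' : (1 : ℝ) ≤ n := by exact_mod_cast hn
  have hA : ∀ xs ∈ K, 0 ≤ ∑ t ∈ Finset.range T, F t xs := fun xs hxs =>
    Finset.sum_nonneg fun t ht => (hF t (Finset.mem_range.1 ht)).nonneg _ (hK hxs)
  refine ⟨fun t ht => h.integrable_reward_value ht le_rfl, fun xs hxs => ?_, fun hLT xs hxs => ?_⟩
  · -- On `K` smoothness bounds the total variation of the gradients by `L · β D / L`.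
    have main := h.sum_integral_ge hn (S := β * Metric.diam K) (by positivity) (fun t ht ω => by
      refine (Finset.sum_le_sum (g := fun _ => β * (1 / L * Metric.diam K)) fun l hl => ?_).trans
        (le_of_eq ?_)
      · have hl' := Finset.mem_range.1 hl
        refine ((hF t ht).smooth _ (h.x_mem ht hl' ω) _ (h.x_mem ht hl'.le ω)).trans ?_
        exact mul_le_mul_of_nonneg_left (OnlineDR.norm_iter_succ_sub_le hne hK hconv hdown
          (fun j hj => (h.u_mem ht hj ω).1) hl') hβ
      · rw [Finset.sum_const, Finset.card_range, nsmul_eq_mul]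
        field_simp) hxs
    refine le_trans ?_ main
    have h1 : 0 ≤ (n : ℝ) ^ (3 / 4 : ℝ) * G * (T : ℝ) ^ (3 / 4 : ℝ) := by positivity
    have h2 : 0 ≤ (β * Metric.diam K + G + σ) * Metric.diam K * T / (L : ℝ) ^ (1 / 3 : ℝ) := by
      positivity
    have h3 : 0 ≤ (112 + 2 * c) / L * ∑ t ∈ Finset.range T, F t xs :=
      mul_nonneg (by positivity) (hA xs hxs)
    rw [sub_mul]
    have h4 : (42 + 2 * c) * ((n : ℝ) ^ (3 / 4 : ℝ) * G * (T : ℝ) ^ (3 / 4 : ℝ))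
        ≤ (112 + 2 * c) * ((n : ℝ) ^ (3 / 4 : ℝ) * G * (T : ℝ) ^ (3 / 4 : ℝ)) := by
      gcongr; norm_num
    have h5 : 14 * ((β * Metric.diam K + G + σ) * Metric.diam K * T / (L : ℝ) ^ (1 / 3 : ℝ))
        ≤ (112 + 2 * c)
          * ((β * Metric.diam K + G + σ) * Metric.diam K * T / (L : ℝ) ^ (1 / 3 : ℝ)) := by
      gcongr; linarith
    linarith
  · -- Without reference to `β`: the iterates increase, so the gradients decrease.
    have main := h.sum_integral_ge hn (S := 4 * G * √n) (by positivity) (fun t ht ω =>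
      OnlineDR.sum_norm_grad_sub_le hG (hF t ht).differentiable (hF t ht).dr (hF t ht).lipschitz
        (fun l => R.x L t l ω) L (fun l hl => h.x_mem_cube ht hl ω)
        fun l _ i => OnlineDR.iter_le_succ l i) hxs
    refine le_trans ?_ main
    set Q := (n : ℝ) ^ (5 / 4 : ℝ) * (T : ℝ) ^ (3 / 4 : ℝ) with hQ
    have h3 : 0 ≤ (112 + 2 * c) / (T : ℝ) ^ (3 / 4 : ℝ) * ∑ t ∈ Finset.range T, F t xs :=
      mul_nonneg (by positivity) (hA xs hxs)
    have h4 : (n : ℝ) ^ (3 / 4 : ℝ) * G * (T : ℝ) ^ (3 / 4 : ℝ) ≤ (G + σ) * Q := by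
      have : (n : ℝ) ^ (3 / 4 : ℝ) ≤ (n : ℝ) ^ (5 / 4 : ℝ) :=
        Real.rpow_le_rpow_of_exponent_le hn' (by norm_num)
      calc _ = G * ((n : ℝ) ^ (3 / 4 : ℝ) * (T : ℝ) ^ (3 / 4 : ℝ)) := by ring
        _ ≤ (G + σ) * Q := by rw [hQ]; gcongr; linarith
    have h5 : (T : ℝ) / (L : ℝ) ^ (1 / 3 : ℝ) ≤ (T : ℝ) ^ (3 / 4 : ℝ) := by
      have h6 : (T : ℝ) ^ (1 / 4 : ℝ) ≤ (L : ℝ) ^ (1 / 3 : ℝ) := by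
        have h7 : (T : ℝ) ^ (3 / 4 : ℝ) ≤ L := by rw [hLT]; exact Nat.le_ceil _
        calc (T : ℝ) ^ (1 / 4 : ℝ) = ((T : ℝ) ^ (3 / 4 : ℝ)) ^ (1 / 3 : ℝ) := by
              rw [← Real.rpow_mul (by linarith)]; norm_num
          _ ≤ _ := Real.rpow_le_rpow (by positivity) h7 (by norm_num)
      rw [div_le_iff₀ (by positivity)]
      calc (T : ℝ) = (T : ℝ) ^ (3 / 4 : ℝ) * (T : ℝ) ^ (1 / 4 : ℝ) := by
            rw [← Real.rpow_add (by linarith)]; norm_num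
        _ ≤ _ := by gcongr
    have h6 : (4 * G * √n + G + σ) * Metric.diam K * T / (L : ℝ) ^ (1 / 3 : ℝ)
        ≤ 5 * ((G + σ) * Q) := by
      have hs1 : 1 ≤ √(n : ℝ) := Real.one_le_sqrt.2 hn'
      have hs2 : √(n : ℝ) * √n = n := Real.mul_self_sqrt (by positivity)
      have h7 : 4 * G * √n + G + σ ≤ 5 * (G + σ) * √n := by nlinarith
      have h8 : (n : ℝ) ≤ (n : ℝ) ^ (5 / 4 : ℝ) := by
        calc (n : ℝ) = (n : ℝ) ^ (1 : ℝ) := (Real.rpow_one _).symm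
          _ ≤ _ := Real.rpow_le_rpow_of_exponent_le hn' (by norm_num)
      calc _ = (4 * G * √n + G + σ) * Metric.diam K * (T / (L : ℝ) ^ (1 / 3 : ℝ)) := by ring
        _ ≤ (5 * (G + σ) * √n) * √n * (T : ℝ) ^ (3 / 4 : ℝ) := by
            gcongr
            exact OnlineDR.diam_le_sqrt hK
        _ = 5 * ((G + σ) * (n * (T : ℝ) ^ (3 / 4 : ℝ))) := by
            linear_combination (5 * (G + σ) * (T : ℝ) ^ (3 / 4 : ℝ)) * hs2
        _ ≤ _ := by rw [hQ]; gcongr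
    have h7 := mul_le_mul_of_nonneg_left h4 (by linarith : 0 ≤ 42 + 2 * c)
    rw [sub_mul]
    have e : (G + σ) * (n : ℝ) ^ (5 / 4 : ℝ) * (T : ℝ) ^ (3 / 4 : ℝ) = (G + σ) * Q := by
      rw [hQ]; ring
    rw [e]
    linarith
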